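/- Let $m>1/2$ and $\theta\in\mathbb R$. For $\mu\in\mathbb R$ and $\sigma>0$ let $\mathrm{PVII}_m(\mu,\sigma)$ be the Pearson Type VII distribution, with density $c_m\,\sigma^{-1}\bigl(1+((x-\mu)/\sigma)^2\bigr)^{-m}$, where $c_m=\bigl(\int_{\mathbb R}(1+x^2)^{-m}\,dx\bigr)^{-1}$; let $f$ be the density of $\mathrm{PVII}_m(0,1)$. Let $X_1,X_2,\dots$ be i.i.d. random variables on a probability space $(\Omega,\mathcal F,P)$ with law $\mathrm{PVII}_m(\theta,1)$. For each $n\ge1$ let $\hat\theta_n=\hat\theta_n(X_1,\dots,X_n)$ be a maximum likelihood estimator of the location, that is, $\hat\theta_n(\cdot):\mathbb R^n\to\mathbb R$ is any measurable function such that, for every $(x_1,\dots,x_n)\in\mathbb R^n$, the value $\hat\theta_n(x_1,\dots,x_n)$ is a global maximizer of $t\mapsto\prod_{i=1}^n f(x_i-t)$. Then the following hold. (i) $$\limsup_{\epsilon\to+0}\frac1{\epsilon^2}\left(\limsup_{n\to\infty}\frac{\log P(|\hat\theta_n-\theta|>\epsilon)}{n}\right)\le-\frac{m(2m-1)}{2(m+1)}$$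 and $$\liminf_{\epsilon\to+0}\frac1{\epsilon^2}\left(\liminf_{n\to\infty}\frac{\log P(|\hat\theta_n-\theta|>\epsilon)}{n}\right)\ge-\frac{m(2m-1)}{2(m+1)}.$$ (ii) For every sequence $(\lambda_n)_{n\ge1}$ of positive numbers with $\lim_{n\to\infty}\lambda_n=\infty$ and $\lim_{n\to\infty}\lambda_n/n^{1/2}=0$, and every $\epsilon>0$, $$\lim_{n\to\infty}\frac{\log P(|\hat\theta_n-\theta|>\epsilon/\lambda_n)}{n/\lambda_n^2}=-\frac{m(2m-1)}{2(m+1)}\,\epsilon^2.$$ Here $\log 0=-\infty$, and the limits are taken in $[-\infty,\infty]$. -/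

import Mathlib

open MeasureTheory ProbabilityTheory Filter Topology

noncomputable section

/-- The normalizing constant of the Pearson Type VII density with parameter `m`. -/
def pviiConst (m : ℝ) : ℝ := (∫ x : ℝ, (1 + x ^ 2) ^ (-m))⁻¹

/-- The Pearson Type VII density with location `μ` and scale `σ`. -/
def pviiPDF (m μ σ x : ℝ) : ℝ :=
  pviiConst m * (1 / σ) * (1 + ((x - μ) / σ) ^ 2) ^ (-m)

/-- The Pearson Type VII distribution with location `μ` and scale `σ`. -/
def pviiMeasure (m μ σ : ℝ) : Measure ℝ :=
  volume.withDensity fun x => ENNReal.ofReal (pviiPDF m μ σ x)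

/-- The likelihood of the location `t` (with scale `1`) given the sample `x`. -/
def pviiLikelihood (m : ℝ) {n : ℕ} (x : Fin n → ℝ) (t : ℝ) : ℝ :=
  ∏ i, pviiPDF m 0 1 (x i - t)

/-- `g` is a maximum likelihood estimator of the location from samples of size `n`: a measurable
function of the sample which is everywhere a global maximizer of the likelihood. -/
structure IsPviiMLE (m : ℝ) (n : ℕ) (g : (Fin n → ℝ) → ℝ) : Prop where
  measurable : Measurable g
  maximizes : ∀ (x : Fin n → ℝ) (t : ℝ), pviiLikelihood m x t ≤ pviiLikelihood m x (g x)

/-- The logarithm, in `[-∞, ∞]`, of the probability `P(|θ̂ₙ - θ| > r)`, where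
`θ̂ₙ = g n (X₀, …, Xₙ₋₁)` is the estimate from the first `n` observations. -/
def logDevProb {Ω : Type*} [MeasurableSpace Ω] (P : Measure Ω) (X : ℕ → Ω → ℝ)
    (g : (n : ℕ) → (Fin n → ℝ) → ℝ) (θ : ℝ) (n : ℕ) (r : ℝ) : EReal :=
  ENNReal.log (P {ω | r < |g n (fun i => X i ω) - θ|})

end

/-! By translation take θ = 0. The estimator minimizes ∑ `logLoss` (xᵢ - t), hence is a zero of t ↦
∑ `score` (xᵢ - t). Write J = (2m - 1)/(m + 1) for the mean of `scoreDeriv`. The mean of `score`² is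
J/m (information identity), so the Fisher information is mJ and the claimed rate is half of it.

Two events are exponentially unlikely at a fixed rate: the estimator lying far from 0
(`expSmall_abs_mle_gt`, from Gibbs' inequality, compactness and a tail estimate), and the empirical
mean of `scoreDeriv` being at most J/2. Otherwise the summed score is strictly decreasing near 0, so
whether the estimator exceeds r is read off the sign of ∑ `score` (xᵢ - r), a sum of bounded i.i.d.
terms.

The upper bound is Chernoff's inequality with tilt mr, whose exponent is -mJr²/2 + O(r³)
(`integral_exp_mul_score_sub_le`). The lower bound changes the measure to location (1 + κ)r, under
which the score at r is typically positive, at a likelihood cost close to nmJr²/2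
(`exists_half_le_measureReal_pi_shift`). Both hold uniformly for small r and large nr²
(`exists_measureReal_abs_mle_gt_bounds`). Taking r = ε fixed gives (i), and r = ε/λₙ gives (ii). -/

/-! ### Calculus of the loss: bounds and Taylor estimates -/

/-- The loss `log (1 + x²)` whose sum over the residuals is minimized by the estimator. -/
noncomputable def logLoss (x : ℝ) : ℝ := Real.log (1 + x ^ 2)

/-- The derivative of `logLoss`. -/
noncomputable def score (x : ℝ) : ℝ := 2 * x / (1 + x ^ 2)

/-- The derivative of `score`. -/
noncomputable def scoreDeriv (x : ℝ) : ℝ := (2 - 2 * x ^ 2) / (1 + x ^ 2) ^ 2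

lemma hasDerivAt_logLoss (x : ℝ) : HasDerivAt logLoss (score x) x := by
  have h : HasDerivAt (fun x : ℝ => 1 + x ^ 2) (2 * x) x := by
    simpa using (hasDerivAt_pow 2 x).const_add 1
  exact h.log (by positivity)

lemma hasDerivAt_score (x : ℝ) : HasDerivAt score (scoreDeriv x) x := by
  have h : HasDerivAt (fun x : ℝ => 1 + x ^ 2) (2 * x) x := by
    simpa using (hasDerivAt_pow 2 x).const_add 1
  have h2 : HasDerivAt (fun x : ℝ => 2 * x) 2 x := by
    simpa using (hasDerivAt_id x).const_mul 2
  refine (h2.div h (by positivity)).congr_deriv ?_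
  unfold scoreDeriv
  congr 1
  ring

lemma hasDerivAt_scoreDeriv (x : ℝ) :
    HasDerivAt scoreDeriv ((4 * x ^ 3 - 12 * x) / (1 + x ^ 2) ^ 3) x := by
  have h : HasDerivAt (fun x : ℝ => (1 + x ^ 2) ^ 2) (2 * (1 + x ^ 2) * (2 * x)) x := by
    have h : HasDerivAt (fun x : ℝ => 1 + x ^ 2) (2 * x) x := by
      simpa using (hasDerivAt_pow 2 x).const_add 1
    exact (h.pow 2).congr_deriv (by simp)
  have h2 : HasDerivAt (fun x : ℝ => 2 - 2 * x ^ 2) (-(4 * x)) x := by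
    have := ((hasDerivAt_pow 2 x).const_mul 2).const_sub 2
    refine this.congr_deriv ?_
    simp; ring
  refine (h2.div h (by positivity)).congr_deriv ?_
  have : (1 + x ^ 2) ≠ 0 := by positivity
  field_simp
  ring

lemma abs_score_le (x : ℝ) : |score x| ≤ 1 := by
  unfold score
  rw [abs_div, abs_of_pos (by positivity : (0:ℝ) < 1 + x ^ 2), div_le_one (by positivity), abs_le]
  constructor <;> nlinarith [sq_nonneg (x - 1), sq_nonneg (x + 1)]

lemma abs_scoreDeriv_le (x : ℝ) : |scoreDeriv x| ≤ 2 := by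
  unfold scoreDeriv
  rw [abs_div, abs_of_pos (by positivity : (0:ℝ) < (1 + x ^ 2) ^ 2), div_le_iff₀ (by positivity),
    abs_le]
  constructor <;> nlinarith [sq_nonneg x, sq_nonneg (x ^ 2)]

lemma score_neg (x : ℝ) : score (-x) = -score x := by
  unfold score; rw [neg_sq]; ring

lemma continuous_logLoss : Continuous logLoss :=
  continuous_iff_continuousAt.2 fun x => (hasDerivAt_logLoss x).continuousAt

lemma continuous_score : Continuous score :=
  continuous_iff_continuousAt.2 fun x => (hasDerivAt_score x).continuousAt

lemma continuous_scoreDeriv : Continuous scoreDeriv :=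
  continuous_iff_continuousAt.2 fun x => (hasDerivAt_scoreDeriv x).continuousAt

lemma abs_sub_le_of_hasDerivAt_of_abs_le {f f' : ℝ → ℝ} (hf : ∀ x, HasDerivAt f (f' x) x)
    {x r C : ℝ} (hC : ∀ u, |u - x| ≤ |r| → |f' u| ≤ C) : |f (x + r) - f x| ≤ C * |r| := by
  have := Convex.norm_image_sub_le_of_norm_hasDerivWithin_le (f := f) (f' := f') (C := C)
    (s := Set.uIcc x (x + r)) (x := x) (y := x + r) (fun u _ => (hf u).hasDerivWithinAt)
    (fun u hu => hC u (by simpa using Set.abs_sub_left_of_mem_uIcc hu))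
    (convex_uIcc _ _) Set.left_mem_uIcc Set.right_mem_uIcc
  simpa using this

lemma abs_logLoss_add_sub_le (x r : ℝ) : |logLoss (x + r) - logLoss x| ≤ |r| := by
  simpa using abs_sub_le_of_hasDerivAt_of_abs_le hasDerivAt_logLoss (x := x) (r := r) (C := 1)
    fun u _ => abs_score_le u

lemma abs_scoreDeriv_add_sub_le (x r : ℝ) : |scoreDeriv (x + r) - scoreDeriv x| ≤ 16 * |r| := by
  refine abs_sub_le_of_hasDerivAt_of_abs_le hasDerivAt_scoreDeriv (x := x) (r := r) (C := 16) ?_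
  intro u _
  rw [abs_div, abs_of_pos (by positivity : (0:ℝ) < (1 + u ^ 2) ^ 3), div_le_iff₀ (by positivity),
    abs_le]
  constructor <;> nlinarith [sq_nonneg u, sq_nonneg (u ^ 2), sq_nonneg (u ^ 3), sq_nonneg (u - 1),
    sq_nonneg (u + 1), sq_nonneg (u ^ 2 - u), sq_nonneg (u ^ 2 + u)]

lemma abs_score_add_sub_sub_le (x r : ℝ) :
    |score (x + r) - score x - r * scoreDeriv x| ≤ 16 * r ^ 2 := by
  have := abs_sub_le_of_hasDerivAt_of_abs_le (f := fun u => score u - (u - x) * scoreDeriv x)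
    (f' := fun u => scoreDeriv u - scoreDeriv x) (x := x) (r := r) (C := 16 * |r|)
    (fun u => by
      exact ((hasDerivAt_score u).sub
        (((hasDerivAt_id u).sub_const x).mul_const (scoreDeriv x))).congr_deriv (by simp))
    (fun u hu => by
      have := abs_scoreDeriv_add_sub_le x (u - x)
      simp only [add_sub_cancel] at this
      linarith)
  rw [mul_assoc, abs_mul_abs_self] at this
  simp only [add_sub_cancel_left, sub_self, zero_mul, sub_zero] at this
  rw [sq]
  convert this using 2
  ring

lemma abs_logLoss_add_sub_sub_le (x r : ℝ) :
    |logLoss (x + r) - logLoss x - r * score x - r ^ 2 / 2 * scoreDeriv x| ≤ 16 * |r| ^ 3 := by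
  have := abs_sub_le_of_hasDerivAt_of_abs_le
    (f := fun u => logLoss u - (u - x) * score x - (u - x) ^ 2 / 2 * scoreDeriv x)
    (f' := fun u => score u - score x - (u - x) * scoreDeriv x) (x := x) (r := r) (C := 16 * |r| ^ 2)
    (fun u => by
      have h2 : HasDerivAt (fun u : ℝ => (u - x) ^ 2 / 2 * scoreDeriv x) ((u - x) * scoreDeriv x) u := by
        refine (((((hasDerivAt_id u).sub_const x).pow 2).div_const 2).mul_const _).congr_deriv ?_
        simp
      exact (((hasDerivAt_logLoss u).sub
        (((hasDerivAt_id u).sub_const x).mul_const (score x))).sub h2).congr_deriv (by simp))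
    (fun u hu => by
      have := abs_score_add_sub_sub_le x (u - x)
      simp only [add_sub_cancel] at this
      have h2 : (u - x) ^ 2 ≤ |r| ^ 2 := by rw [← sq_abs (u - x)]; gcongr
      linarith)
  simp only [add_sub_cancel_left, sub_self, zero_mul, sub_zero] at this
  refine (le_of_eq ?_).trans (this.trans (le_of_eq (by ring)))
  congr 1
  ring

lemma logLoss_neg (x : ℝ) : logLoss (-x) = logLoss x := by
  unfold logLoss; rw [neg_sq]

/-- Since 1 + (x + y)² ≤ 2(1 + x²)(1 + y²). This controls the loss at remote locations, where the
Lipschitz bound is useless. -/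
lemma logLoss_add_le (x y : ℝ) : logLoss (x + y) ≤ Real.log 2 + logLoss x + logLoss y := by
  unfold logLoss
  rw [← Real.log_mul (by positivity) (by positivity), ← Real.log_mul (by positivity) (by positivity)]
  apply Real.log_le_log (by positivity)
  nlinarith [sq_nonneg (x - y), mul_nonneg (sq_nonneg x) (sq_nonneg y)]

/-! ### Integrals of powers of 1 + x² and the Pearson VII law -/

lemma integrable_one_add_sq_rpow_neg {k : ℝ} (hk : 1 / 2 < k) :
    Integrable fun x : ℝ => (1 + x ^ 2) ^ (-k) := by
  have := integrable_rpow_neg_one_add_norm_sq (E := ℝ) (μ := volume) (r := 2 * k) (by simp; linarith)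
  simpa [show -(2 * k) / 2 = -k by ring] using this

lemma tendsto_mul_one_add_sq_rpow_neg {k : ℝ} (hk : 1 / 2 < k) :
    Tendsto (fun x : ℝ => x * (1 + x ^ 2) ^ (-k)) atTop (𝓝 0) := by
  have h0 : Tendsto (fun x : ℝ => x ^ (-(2 * k - 1))) atTop (𝓝 0) :=
    tendsto_rpow_neg_atTop (by linarith)
  refine squeeze_zero' ?_ ?_ h0
  · filter_upwards [eventually_gt_atTop 0] with x hx
    positivity
  · filter_upwards [eventually_gt_atTop 0] with x hx
    have h1 : (1 + x ^ 2) ^ (-k) ≤ (x ^ 2) ^ (-k) :=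
      Real.rpow_le_rpow_of_nonpos (by positivity) (by linarith) (by linarith)
    have h2 : x ^ (-(2 * k - 1)) = x * (x ^ 2) ^ (-k) := by
      rw [← Real.rpow_natCast_mul hx.le, show -(2 * k - 1) = 1 + ((2 : ℕ) : ℝ) * -k by push_cast; ring,
        Real.rpow_add hx, Real.rpow_one]
    rw [h2]
    gcongr

/-- The derivative of x(1 + x²)^(-k) is a combination of the two integrands, and its integral
vanishes because the boundary terms do when 2k > 1. -/
lemma integral_one_add_sq_rpow_neg_succ {k : ℝ} (hk : 1 / 2 < k) :
    ∫ x : ℝ, (1 + x ^ 2) ^ (-(k + 1)) =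
      (2 * k - 1) / (2 * k) * ∫ x : ℝ, (1 + x ^ 2) ^ (-k) := by
  have hpos : ∀ x : ℝ, 0 < 1 + x ^ 2 := fun x => by positivity
  have hd : ∀ x : ℝ, HasDerivAt (fun x : ℝ => x * (1 + x ^ 2) ^ (-k))
      ((1 - 2 * k) * (1 + x ^ 2) ^ (-k) + 2 * k * (1 + x ^ 2) ^ (-(k + 1))) x := by
    intro x
    have h : HasDerivAt (fun x : ℝ => 1 + x ^ 2) (2 * x) x := by
      simpa using (hasDerivAt_pow 2 x).const_add 1
    refine ((hasDerivAt_id x).mul (h.rpow_const (p := -k) (Or.inl (hpos x).ne'))).congr_deriv ?_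
    have h1 : (1 + x ^ 2) ^ (-k) = (1 + x ^ 2) ^ (-(k + 1)) * (1 + x ^ 2) := by
      rw [← Real.rpow_add_one (hpos x).ne']; congr 1; ring
    rw [show -k - 1 = -(k + 1) by ring, h1]
    simp only [id]
    ring
  have i1 := integrable_one_add_sq_rpow_neg hk
  have i2 := integrable_one_add_sq_rpow_neg (k := k + 1) (by linarith)
  have hb : Tendsto (fun x : ℝ => x * (1 + x ^ 2) ^ (-k)) atBot (𝓝 0) := by
    have := ((tendsto_mul_one_add_sq_rpow_neg hk).comp tendsto_neg_atBot_atTop).neg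
    simpa [Function.comp_def] using this
  have := integral_of_hasDerivAt_of_tendsto hd ((i1.const_mul _).add (i2.const_mul _)) hb
    (tendsto_mul_one_add_sq_rpow_neg hk)
  rw [integral_add (i1.const_mul _) (i2.const_mul _), integral_const_mul, integral_const_mul] at this
  field_simp
  linarith

lemma integral_one_add_sq_rpow_neg_pos {m : ℝ} (hm : 1 / 2 < m) :
    0 < ∫ x : ℝ, (1 + x ^ 2) ^ (-m) := by
  refine integral_pos_of_integrable_nonneg_nonzero (x := 0) ?_ (integrable_one_add_sq_rpow_neg hm)
    (fun x => by positivity) (by simp)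
  exact (by fun_prop : Continuous fun x : ℝ => 1 + x ^ 2).rpow_const
    fun x => Or.inl (by positivity)

lemma pviiConst_pos {m : ℝ} (hm : 1 / 2 < m) : 0 < pviiConst m :=
  inv_pos.2 (integral_one_add_sq_rpow_neg_pos hm)

lemma pviiPDF_one (m μ x : ℝ) :
    pviiPDF m μ 1 x = pviiConst m * (1 + (x - μ) ^ 2) ^ (-m) := by
  simp [pviiPDF]

lemma pviiPDF_one_eq_exp (m μ x : ℝ) :
    pviiPDF m μ 1 x = pviiConst m * Real.exp (-m * logLoss (x - μ)) := by
  rw [pviiPDF_one, logLoss, Real.rpow_def_of_pos (by positivity), mul_comm (-m)]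

lemma pviiPDF_one_pos {m : ℝ} (hm : 1 / 2 < m) (μ x : ℝ) : 0 < pviiPDF m μ 1 x := by
  rw [pviiPDF_one_eq_exp]
  exact mul_pos (pviiConst_pos hm) (Real.exp_pos _)

lemma continuous_pviiPDF_one (m μ : ℝ) : Continuous (pviiPDF m μ 1) := by
  have : pviiPDF m μ 1 = fun x => pviiConst m * Real.exp (-m * logLoss (x - μ)) :=
    funext (pviiPDF_one_eq_exp m μ)
  rw [this]
  have := continuous_logLoss
  fun_prop

lemma integrable_pviiPDF_one {m : ℝ} (hm : 1 / 2 < m) (μ : ℝ) : Integrable (pviiPDF m μ 1) := by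
  rw [show pviiPDF m μ 1 = fun x => pviiConst m * (1 + (x - μ) ^ 2) ^ (-m) from
    funext (pviiPDF_one m μ)]
  exact ((integrable_one_add_sq_rpow_neg hm).comp_sub_right μ).const_mul _

lemma integral_pviiMeasure {m : ℝ} (hm : 1 / 2 < m) (μ : ℝ) (φ : ℝ → ℝ) :
    ∫ x, φ x ∂pviiMeasure m μ 1 = ∫ x, pviiPDF m μ 1 x * φ x := by
  rw [pviiMeasure, integral_withDensity_eq_integral_toReal_smul
    (continuous_pviiPDF_one m μ).measurable.ennreal_ofReal (by simp)]
  simp [ENNReal.toReal_ofReal (pviiPDF_one_pos hm μ _).le]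

lemma isProbabilityMeasure_pviiMeasure {m : ℝ} (hm : 1 / 2 < m) (μ : ℝ) :
    IsProbabilityMeasure (pviiMeasure m μ 1) := by
  refine ⟨?_⟩
  rw [pviiMeasure, withDensity_apply _ MeasurableSet.univ, Measure.restrict_univ,
    ← ofReal_integral_eq_lintegral_ofReal (integrable_pviiPDF_one hm μ)
      (ae_of_all _ fun x => (pviiPDF_one_pos hm μ x).le)]
  simp_rw [pviiPDF_one]
  rw [integral_const_mul, integral_sub_right_eq_self fun x : ℝ => (1 + x ^ 2) ^ (-m), pviiConst,
    inv_mul_cancel₀ (integral_one_add_sq_rpow_neg_pos hm).ne', ENNReal.ofReal_one]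

lemma integral_pviiMeasure_eq_comp_add {m : ℝ} (hm : 1 / 2 < m) (μ : ℝ) (φ : ℝ → ℝ) :
    ∫ x, φ x ∂pviiMeasure m μ 1 = ∫ x, φ (x + μ) ∂pviiMeasure m 0 1 := by
  rw [integral_pviiMeasure hm, integral_pviiMeasure hm,
    ← integral_sub_right_eq_self (fun x => pviiPDF m 0 1 x * φ (x + μ)) μ]
  simp [pviiPDF_one]

lemma map_sub_pviiMeasure (m μ : ℝ) :
    (pviiMeasure m μ 1).map (fun x => x - μ) = pviiMeasure m 0 1 := by
  ext s hs
  rw [Measure.map_apply (by fun_prop) hs, pviiMeasure, pviiMeasure, withDensity_apply _ hs,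
    withDensity_apply _ (hs.preimage (by fun_prop)), ← lintegral_indicator hs,
    ← lintegral_indicator (hs.preimage (by fun_prop)),
    ← lintegral_sub_right_eq_self (s.indicator fun x => ENNReal.ofReal (pviiPDF m 0 1 x)) μ]
  congr 1
  ext x
  by_cases h : x - μ ∈ s <;> simp [h, pviiPDF_one]

lemma pviiMeasure_eq_withDensity {m : ℝ} (hm : 1 / 2 < m) (μ : ℝ) :
    pviiMeasure m μ 1 = (pviiMeasure m 0 1).withDensity
      fun x => ENNReal.ofReal (Real.exp (m * (logLoss x - logLoss (x - μ)))) := by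
  have := continuous_logLoss
  rw [pviiMeasure, pviiMeasure, ← withDensity_mul _
    (continuous_pviiPDF_one m 0).measurable.ennreal_ofReal (by fun_prop)]
  congr 1
  ext x
  rw [Pi.mul_apply, ← ENNReal.ofReal_mul (pviiPDF_one_pos hm 0 x).le, pviiPDF_one_eq_exp,
    pviiPDF_one_eq_exp, mul_assoc, ← Real.exp_add]
  congr 3
  rw [sub_zero]
  ring

/-! ### Moments of the score and Gibbs' inequality -/

lemma integrable_of_continuous_of_abs_le {ν : Measure ℝ} [IsFiniteMeasure ν] {φ : ℝ → ℝ}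
    (hφ : Continuous φ) {b : ℝ} (hb : ∀ x, |φ x| ≤ b) : Integrable φ ν :=
  Integrable.of_bound hφ.aestronglyMeasurable b (ae_of_all _ hb)

lemma integrable_score {ν : Measure ℝ} [IsFiniteMeasure ν] : Integrable score ν :=
  integrable_of_continuous_of_abs_le continuous_score abs_score_le

lemma integrable_scoreDeriv {ν : Measure ℝ} [IsFiniteMeasure ν] : Integrable scoreDeriv ν :=
  integrable_of_continuous_of_abs_le continuous_scoreDeriv abs_scoreDeriv_le

lemma integrable_score_sq {ν : Measure ℝ} [IsFiniteMeasure ν] :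
    Integrable (fun x => score x ^ 2) ν :=
  integrable_of_continuous_of_abs_le (b := 1) (continuous_score.pow 2) fun x => by
    rw [abs_pow]; exact pow_le_one₀ (abs_nonneg _) (abs_score_le x)

lemma integral_score {m : ℝ} (hm : 1 / 2 < m) : ∫ x, score x ∂pviiMeasure m 0 1 = 0 := by
  rw [integral_pviiMeasure hm]
  have := integral_neg_eq_self (fun x => pviiPDF m 0 1 x * score x) volume
  have h2 : (fun x => pviiPDF m 0 1 (-x) * score (-x)) = fun x => -(pviiPDF m 0 1 x * score x) := by
    ext x
    simp [pviiPDF_one, score_neg]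
  rw [h2, integral_neg] at this
  linarith

/-- `scoreDeriv` equals 4(1 + x²)⁻² - 2(1 + x²)⁻¹, so the recursion in the exponent evaluates the
mean. -/
lemma integral_scoreDeriv {m : ℝ} (hm : 1 / 2 < m) :
    ∫ x, scoreDeriv x ∂pviiMeasure m 0 1 = (2 * m - 1) / (m + 1) := by
  have i1 := integrable_one_add_sq_rpow_neg (k := m + 1) (by linarith)
  have i2 := integrable_one_add_sq_rpow_neg (k := m + 1 + 1) (by linarith)
  have h : (fun x => pviiPDF m 0 1 x * scoreDeriv x) = fun x : ℝ =>
      pviiConst m * (4 * (1 + x ^ 2) ^ (-(m + 1 + 1)) - 2 * (1 + x ^ 2) ^ (-(m + 1))) := by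
    ext x
    have hx : (0:ℝ) < 1 + x ^ 2 := by positivity
    rw [pviiPDF_one, scoreDeriv, sub_zero, neg_add (m + 1), neg_add m, ← sub_eq_add_neg,
      ← sub_eq_add_neg, Real.rpow_sub_one hx.ne' (-m - 1), Real.rpow_sub_one hx.ne']
    field_simp
    ring
  rw [integral_pviiMeasure hm, h, integral_const_mul,
    integral_sub (i2.const_mul _) (i1.const_mul _), integral_const_mul, integral_const_mul,
    integral_one_add_sq_rpow_neg_succ (k := m + 1) (by linarith),
    integral_one_add_sq_rpow_neg_succ hm, pviiConst]
  have := (integral_one_add_sq_rpow_neg_pos hm).ne'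
  have hm0 : m ≠ 0 := by linarith
  have hm1 : m + 1 ≠ 0 := by linarith
  field_simp
  ring

/-- With the preceding lemma this is the information identity m² E[`score`²] = m E[`scoreDeriv`],
which makes the Chernoff and change-of-measure exponents agree. -/
lemma integral_score_sq {m : ℝ} (hm : 1 / 2 < m) :
    ∫ x, score x ^ 2 ∂pviiMeasure m 0 1 = (2 * m - 1) / (m + 1) / m := by
  have i1 := integrable_one_add_sq_rpow_neg (k := m + 1) (by linarith)
  have i2 := integrable_one_add_sq_rpow_neg (k := m + 1 + 1) (by linarith)
  have h : (fun x => pviiPDF m 0 1 x * score x ^ 2) = fun x : ℝ =>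
      pviiConst m * (4 * (1 + x ^ 2) ^ (-(m + 1)) - 4 * (1 + x ^ 2) ^ (-(m + 1 + 1))) := by
    ext x
    have hx : (0:ℝ) < 1 + x ^ 2 := by positivity
    rw [pviiPDF_one, score, sub_zero, neg_add (m + 1), neg_add m, ← sub_eq_add_neg, ← sub_eq_add_neg,
      Real.rpow_sub_one hx.ne' (-m - 1), Real.rpow_sub_one hx.ne']
    field_simp
    ring
  rw [integral_pviiMeasure hm, h, integral_const_mul,
    integral_sub (i1.const_mul _) (i2.const_mul _), integral_const_mul, integral_const_mul,
    integral_one_add_sq_rpow_neg_succ (k := m + 1) (by linarith),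
    integral_one_add_sq_rpow_neg_succ hm, pviiConst]
  have := (integral_one_add_sq_rpow_neg_pos hm).ne'
  have hm0 : m ≠ 0 := by linarith
  have hm1 : m + 1 ≠ 0 := by linarith
  field_simp
  ring

lemma abs_logLoss_sub_sub_le (x t : ℝ) : |logLoss (x - t) - logLoss x| ≤ |t| := by
  simpa [sub_eq_add_neg] using abs_logLoss_add_sub_le x (-t)

lemma integrable_logLoss_sub_sub {ν : Measure ℝ} [IsFiniteMeasure ν] (t : ℝ) :
    Integrable (fun x => logLoss (x - t) - logLoss x) ν := by
  have := continuous_logLoss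
  exact integrable_of_continuous_of_abs_le (b := |t|) (by fun_prop) (abs_logLoss_sub_sub_le · t)

/-- Gibbs' inequality for the location family: a wrong location has a larger expected loss. -/
lemma integral_logLoss_sub_sub_pos {m : ℝ} (hm : 1 / 2 < m) {t : ℝ} (ht : t ≠ 0) :
    0 < ∫ x, (logLoss (x - t) - logLoss x) ∂pviiMeasure m 0 1 := by
  have hc := continuous_logLoss
  have := isProbabilityMeasure_pviiMeasure hm 0
  -- The law charges every nonempty open set, so a continuous nonnegative function that is nonzero
  -- at one point has positive integral.
  have hac : volume ≪ pviiMeasure m 0 1 := withDensity_absolutelyContinuous'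
    (continuous_pviiPDF_one m 0).measurable.ennreal_ofReal.aemeasurable
    (ae_of_all _ fun x => by simpa using pviiPDF_one_pos hm 0 x)
  have := hac.isOpenPosMeasure
  have i1 := (integrable_logLoss_sub_sub (ν := pviiMeasure m 0 1) t).const_mul m
  have i2 : Integrable (fun x => Real.exp (m * (logLoss x - logLoss (x - t)))) (pviiMeasure m 0 1) := by
    refine integrable_of_continuous_of_abs_le (b := Real.exp (m * |t|)) (by fun_prop) fun x => ?_
    rw [Real.abs_exp]
    have := (abs_le.1 (abs_logLoss_sub_sub_le x t)).1
    gcongr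
    linarith
  have e2 : ∫ x, Real.exp (m * (logLoss x - logLoss (x - t))) ∂pviiMeasure m 0 1 = 1 := by
    rw [integral_pviiMeasure hm]
    have h : (fun x => pviiPDF m 0 1 x * Real.exp (m * (logLoss x - logLoss (x - t)))) =
        fun x => pviiPDF m t 1 x * 1 := by
      ext x
      rw [pviiPDF_one_eq_exp, pviiPDF_one_eq_exp, mul_assoc, ← Real.exp_add, mul_one, sub_zero]
      congr 2
      ring
    have := isProbabilityMeasure_pviiMeasure hm t
    rw [h, ← integral_pviiMeasure hm]
    simp
  -- With u the log-likelihood ratio, exp u - 1 - u is nonnegative, and positive at x = t. As exp u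
  -- has mean 1, the mean of -u is positive.
  have key : 0 < ∫ x, (Real.exp (m * (logLoss x - logLoss (x - t))) +
      m * (logLoss (x - t) - logLoss x) - 1) ∂pviiMeasure m 0 1 := by
    refine integral_pos_of_integrable_nonneg_nonzero (x := t) (by fun_prop)
      ((i2.add i1).sub (integrable_const 1)) (fun x => ?_) ?_
    · have := Real.add_one_le_exp (m * (logLoss x - logLoss (x - t)))
      simp only [Pi.zero_apply]
      linarith
    · have hpos : 0 < logLoss t := Real.log_pos (by have := sq_pos_of_ne_zero ht; linarith)
      have h0 : logLoss (t - t) = 0 := by simp [logLoss]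
      have := Real.add_one_lt_exp (x := m * (logLoss t - logLoss (t - t))) (by
        rw [h0, sub_zero]; positivity)
      linarith
  have i12 : Integrable (fun x => Real.exp (m * (logLoss x - logLoss (x - t))) +
      m * (logLoss (x - t) - logLoss x)) (pviiMeasure m 0 1) := i2.add i1
  rw [integral_sub i12 (integrable_const 1), integral_add i2 i1, e2, integral_const_mul] at key
  simp only [integral_const, probReal_univ, smul_eq_mul, mul_one] at key
  have : 0 < m * ∫ x, (logLoss (x - t) - logLoss x) ∂pviiMeasure m 0 1 := by linarith
  exact pos_of_mul_pos_right this (by linarith)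

/-! ### Product measures: Chernoff, Chebyshev, change of measure -/

section Product

variable {α : Type*} [MeasurableSpace α] {ν : Measure α} [IsProbabilityMeasure ν] {φ : α → ℝ}

/-- Markov's inequality for ∏ exp (φ (xᵢ)), with the Chernoff tilt absorbed into φ. -/
lemma measureReal_pi_sum_nonneg_le (hφ : Integrable (fun x => Real.exp (φ x)) ν) (n : ℕ) :
    (Measure.pi fun _ : Fin n => ν).real {x | 0 ≤ ∑ i, φ (x i)} ≤ (∫ x, Real.exp (φ x) ∂ν) ^ n := by
  have h := mul_meas_ge_le_integral_of_nonneg (μ := Measure.pi fun _ : Fin n => ν)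
    (f := fun x => ∏ i, Real.exp (φ (x i)))
    (ae_of_all _ fun x => Finset.prod_nonneg fun i _ => (Real.exp_pos _).le)
    (Integrable.fintype_prod fun _ => hφ) 1
  rw [integral_fintype_prod_eq_prod (fun _ x => Real.exp (φ x)), one_mul] at h
  simpa [← Real.exp_sum] using h

lemma exists_measureReal_pi_sum_le_exp (hφ : Measurable φ) {b : ℝ} (hb : ∀ x, |φ x| ≤ b) {a : ℝ}
    (ha : a < ∫ x, φ x ∂ν) :
    ∃ c, 0 < c ∧ ∀ n : ℕ, (Measure.pi fun _ : Fin n => ν).real {x | ∑ i, φ (x i) ≤ n * a} ≤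
      Real.exp (-(c * n)) := by
  have hi : Integrable φ ν := Integrable.of_bound hφ.aestronglyMeasurable b (ae_of_all _ hb)
  set e := ∫ x, φ x ∂ν - a with he
  have he0 : 0 < e := by linarith
  set B := |b| + |a| + 1 with hB
  have hB1 : 0 < B := by positivity
  have hY : ∀ x, |φ x - a| ≤ B := fun x => by
    have h1 := abs_sub (φ x) a
    have h2 := (hb x).trans (le_abs_self b)
    linarith
  have heB : e ≤ B := by
    have h1 : ∫ x, φ x ∂ν ≤ ∫ _, |b| ∂ν := integral_mono hi (integrable_const _) fun x =>
      (le_abs_self _).trans ((hb x).trans (le_abs_self b))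
    simp at h1
    have := neg_abs_le a
    linarith
  -- Minimizer of -se + s²B², the bound on the log-moment obtained from exp y ≤ 1 + y + y² for |y| ≤
  -- 1. Since e ≤ B, this s keeps y = -s(φ - a) in that range.
  set s := e / (2 * B ^ 2) with hs
  have hs0 : 0 < s := by positivity
  have hsB : s * B ≤ 1 := by
    rw [hs, div_mul_eq_mul_div, div_le_one (by positivity)]
    nlinarith
  have hsY : ∀ x, |-s * (φ x - a)| ≤ 1 := fun x => by
    rw [abs_mul, abs_neg, abs_of_pos hs0]
    exact (mul_le_mul_of_nonneg_left (hY x) hs0.le).trans hsB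
  have hint : Integrable (fun x => Real.exp (-s * (φ x - a))) ν :=
    Integrable.of_bound (by fun_prop) (Real.exp 1) (ae_of_all _ fun x => by
      rw [Real.norm_eq_abs, Real.abs_exp]
      exact Real.exp_le_exp.2 ((le_abs_self _).trans (hsY x)))
  refine ⟨s * e - s ^ 2 * B ^ 2, ?_, fun n => ?_⟩
  · have : s * e - s ^ 2 * B ^ 2 = e ^ 2 / (4 * B ^ 2) := by rw [hs]; field_simp; ring
    rw [this]; positivity
  have hi2 : Integrable (fun x => s * (φ x - a)) ν := (hi.sub (integrable_const a)).const_mul s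
  have hM : ∫ x, Real.exp (-s * (φ x - a)) ∂ν ≤ Real.exp (-(s * e - s ^ 2 * B ^ 2)) := by
    have h1 : ∫ x, Real.exp (-s * (φ x - a)) ∂ν ≤ ∫ x, (1 + s ^ 2 * B ^ 2 - s * (φ x - a)) ∂ν := by
      refine integral_mono hint ((integrable_const _).sub hi2)
        fun x => ?_
      have h2 := (abs_le.1 (Real.abs_exp_sub_one_sub_id_le (hsY x))).2
      have h3 : (-s * (φ x - a)) ^ 2 ≤ s ^ 2 * B ^ 2 := by
        rw [mul_pow, neg_sq]
        gcongr ?_ * ?_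
        exact sq_le_sq' (abs_le.1 (hY x)).1 (abs_le.1 (hY x)).2
      simp only
      linarith
    rw [integral_sub (integrable_const _) hi2,
      integral_const_mul, integral_sub hi (integrable_const a)] at h1
    simp only [integral_const, probReal_univ, smul_eq_mul, one_mul] at h1
    have := Real.add_one_le_exp (-(s * e - s ^ 2 * B ^ 2))
    linarith
  calc _ ≤ (Measure.pi fun _ : Fin n => ν).real {x | 0 ≤ ∑ i, (-s * (φ (x i) - a))} := by
        refine measureReal_mono fun x hx => ?_
        simp only [Set.mem_ofPred_eq] at hx ⊢
        rw [← Finset.mul_sum, Finset.sum_sub_distrib]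
        simp only [Finset.sum_const, Finset.card_univ, Fintype.card_fin, nsmul_eq_mul]
        nlinarith
    _ ≤ _ := measureReal_pi_sum_nonneg_le hint n
    _ ≤ Real.exp (-(s * e - s ^ 2 * B ^ 2)) ^ n := by
        gcongr
    _ = _ := by rw [← Real.exp_nat_mul]; congr 1; ring

/-- Chebyshev with the variance bounded by b². The explicit constant matters, since φ will depend on
r and uniformity in r is needed. -/
lemma measureReal_pi_abs_sum_sub_ge_le (hφ : Measurable φ) {b : ℝ} (hb : ∀ x, |φ x| ≤ b) {a : ℝ}
    (ha : 0 < a) {n : ℕ} (hn : 1 ≤ n) :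
    (Measure.pi fun _ : Fin n => ν).real {x | n * a ≤ |∑ i, φ (x i) - n * ∫ x, φ x ∂ν|} ≤
      b ^ 2 / (n * a ^ 2) := by
  have hn0 : (0 : ℝ) < n := by exact_mod_cast hn
  have hL : MemLp φ 2 ν := MemLp.of_bound hφ.aestronglyMeasurable b (ae_of_all _ hb)
  have hm (i : Fin n) : MemLp (fun x : Fin n → α => φ (x i)) 2 (Measure.pi fun _ : Fin n => ν) :=
    MemLp.of_bound (hφ.comp (measurable_pi_apply i)).aestronglyMeasurable b
      (ae_of_all _ fun x => hb _)
  have hv := variance_sum_pi (μ := fun _ : Fin n => ν) (X := fun _ => φ) fun _ => hL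
  have hve : Var[φ; ν] ≤ b ^ 2 := by
    have := variance_le_sq_of_bounded (μ := ν) (a := -b) (b := b)
      (ae_of_all _ fun x => abs_le.1 (hb x)) hφ.aemeasurable
    convert this using 1
    ring
  have hE : ∫ x, (∑ i, fun x : Fin n → α => φ (x i)) x ∂(Measure.pi fun _ : Fin n => ν) =
      n * ∫ x, φ x ∂ν := by
    simp only [Finset.sum_apply]
    rw [integral_finsetSum _ fun i _ => (hm i).integrable (by norm_num)]
    have : ∀ i : Fin n, ∫ x : Fin n → α, φ (x i) ∂(Measure.pi fun _ : Fin n => ν) = ∫ x, φ x ∂ν :=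
      fun i => integral_comp_eval (μ := fun _ : Fin n => ν) (i := i) hφ.aestronglyMeasurable
    simp [this]
  have h := meas_ge_le_variance_div_sq (memLp_finsetSum' Finset.univ fun i _ => hm i)
    (c := n * a) (by positivity)
  rw [hE, hv] at h
  have h2 := ENNReal.toReal_mono ENNReal.ofReal_ne_top h
  rw [ENNReal.toReal_ofReal (div_nonneg (Finset.sum_nonneg fun _ _ => variance_nonneg _ _)
    (by positivity))] at h2
  simp only [Finset.sum_apply] at h2
  refine h2.trans ?_
  simp only [Finset.sum_const, Finset.card_univ, Fintype.card_fin, nsmul_eq_mul]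
  rw [div_le_div_iff₀ (by positivity) (by positivity)]
  have : n * Var[φ; ν] * (n * a ^ 2) ≤ n * b ^ 2 * (n * a ^ 2) := by gcongr
  nlinarith

lemma pi_withDensity_eq {f : α → ENNReal} (hf : Measurable f)
    [SigmaFinite (ν.withDensity f)] (n : ℕ) :
    (Measure.pi fun _ : Fin n => ν.withDensity f) =
      (Measure.pi fun _ : Fin n => ν).withDensity fun x => ∏ i, f (x i) := by
  refine Measure.pi_eq fun s hs => ?_
  rw [withDensity_apply _ (MeasurableSet.univ_pi hs), ← lintegral_indicator (MeasurableSet.univ_pi hs)]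
  have h (x : Fin n → α) : (Set.univ.pi s).indicator (fun x => ∏ i, f (x i)) x =
      ∏ i, (s i).indicator f (x i) := by
    by_cases hx : x ∈ Set.univ.pi s
    · rw [Set.indicator_of_mem hx]
      exact Finset.prod_congr rfl fun i _ => (Set.indicator_of_mem (hx i trivial) _).symm
    · rw [Set.indicator_of_notMem hx]
      simp only [Set.mem_pi, Set.mem_univ, true_imp_iff, not_forall] at hx
      obtain ⟨i, hi⟩ := hx
      exact (Finset.prod_eq_zero (Finset.mem_univ i) (Set.indicator_of_notMem hi _)).symm
  simp_rw [h]
  have hmi (i : Fin n) : Measurable ((s i).indicator f) := hf.indicator (hs i)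
  have hind := iIndepFun_pi (μ := fun _ : Fin n => ν) (X := fun i => (s i).indicator f)
    fun i => (hmi i).aemeasurable
  rw [lintegral_prod_eq_prod_lintegral_of_indepFun Finset.univ _ hind
    fun i => (hmi i).comp (measurable_pi_apply i)]
  refine Finset.prod_congr rfl fun i _ => ?_
  rw [withDensity_apply _ (hs i), ← lintegral_indicator (hs i)]
  exact (measurePreserving_eval (fun _ : Fin n => ν) i).lintegral_comp (hmi i)

/-- The product likelihood ratio is exp (∑ w (xᵢ)), at most exp L on S. -/
lemma measureReal_pi_withDensity_le {w : α → ℝ} (hw : Measurable w)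
    [IsProbabilityMeasure (ν.withDensity fun x => ENNReal.ofReal (Real.exp (w x)))] {n : ℕ} {L : ℝ}
    {S : Set (Fin n → α)} (hS : MeasurableSet S) (hL : ∀ x ∈ S, ∑ i, w (x i) ≤ L) :
    (Measure.pi fun _ : Fin n => ν.withDensity fun x => ENNReal.ofReal (Real.exp (w x))).real S ≤
      Real.exp L * (Measure.pi fun _ : Fin n => ν).real S := by
  rw [pi_withDensity_eq (by fun_prop), measureReal_def, measureReal_def, withDensity_apply _ hS,
    ← ENNReal.toReal_ofReal (Real.exp_pos L).le, ← ENNReal.toReal_mul]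
  refine ENNReal.toReal_mono (ENNReal.mul_ne_top ENNReal.ofReal_ne_top (measure_ne_top _ _)) ?_
  rw [← setLIntegral_const]
  refine setLIntegral_mono' hS fun x hx => ?_
  rw [← ENNReal.ofReal_prod_of_nonneg fun i _ => (Real.exp_pos _).le, ← Real.exp_sum]
  exact ENNReal.ofReal_le_ofReal (Real.exp_le_exp.2 (hL x hx))

end Product

/-! ### Exponentially small sequences -/

/-- The sequence `p` is bounded by a decaying exponential. -/
def ExpSmall (p : ℕ → ℝ) : Prop :=
  ∃ A c : ℝ, 0 ≤ A ∧ 0 < c ∧ ∀ n : ℕ, 1 ≤ n → p n ≤ A * Real.exp (-(c * n))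

lemma ExpSmall.mono {p q : ℕ → ℝ} (hq : ExpSmall q) (h : ∀ n, 1 ≤ n → p n ≤ q n) : ExpSmall p := by
  obtain ⟨A, c, hA, hc, hb⟩ := hq
  exact ⟨A, c, hA, hc, fun n hn => (h n hn).trans (hb n hn)⟩

lemma ExpSmall.add {p q : ℕ → ℝ} (hp : ExpSmall p) (hq : ExpSmall q) :
    ExpSmall fun n => p n + q n := by
  obtain ⟨A, c, hA, hc, hb⟩ := hp
  obtain ⟨A', c', hA', hc', hb'⟩ := hq
  refine ⟨A + A', min c c', by positivity, lt_min hc hc', fun n hn => ?_⟩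
  rw [add_mul]
  refine add_le_add ((hb n hn).trans ?_) ((hb' n hn).trans ?_)
  · gcongr; exact min_le_left _ _
  · gcongr; exact min_le_right _ _

/-! ### The score equation for a fixed sample -/

section Deterministic

variable {n : ℕ}

lemma pviiLikelihood_eq (m : ℝ) (x : Fin n → ℝ) (t : ℝ) :
    pviiLikelihood m x t = pviiConst m ^ n * Real.exp (-m * ∑ i, logLoss (x i - t)) := by
  simp only [pviiLikelihood, pviiPDF_one_eq_exp, Finset.prod_mul_distrib, sub_zero,
    Finset.mul_sum, Real.exp_sum]
  simp

lemma IsPviiMLE.sum_logLoss_le {m : ℝ} (hm : 1 / 2 < m) {g : (Fin n → ℝ) → ℝ}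
    (hg : IsPviiMLE m n g) (x : Fin n → ℝ) (t : ℝ) :
    ∑ i, logLoss (x i - g x) ≤ ∑ i, logLoss (x i - t) := by
  have h := hg.maximizes x t
  rw [pviiLikelihood_eq, pviiLikelihood_eq] at h
  have h1 := Real.exp_le_exp.1 (le_of_mul_le_mul_left h (pow_pos (pviiConst_pos hm) n))
  nlinarith

lemma hasDerivAt_sum_score_sub (x : Fin n → ℝ) (t : ℝ) :
    HasDerivAt (fun t => ∑ i, score (x i - t)) (-∑ i, scoreDeriv (x i - t)) t := by
  rw [← Finset.sum_neg_distrib]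
  refine HasDerivAt.fun_sum fun i _ => ?_
  refine ((hasDerivAt_score (x i - t)).comp t ((hasDerivAt_id t).const_sub (x i))).congr_deriv ?_
  simp

lemma IsPviiMLE.sum_score_eq_zero {m : ℝ} (hm : 1 / 2 < m) {g : (Fin n → ℝ) → ℝ}
    (hg : IsPviiMLE m n g) (x : Fin n → ℝ) : ∑ i, score (x i - g x) = 0 := by
  have hd : HasDerivAt (fun t => ∑ i, logLoss (x i - t)) (-∑ i, score (x i - g x)) (g x) := by
    rw [← Finset.sum_neg_distrib]
    refine HasDerivAt.fun_sum fun i _ => ?_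
    refine ((hasDerivAt_logLoss (x i - g x)).comp (g x)
      ((hasDerivAt_id (g x)).const_sub (x i))).congr_deriv ?_
    simp
  have hmin : IsLocalMin (fun t => ∑ i, logLoss (x i - t)) (g x) :=
    Eventually.of_forall fun t => hg.sum_logLoss_le hm x t
  simpa using hmin.hasDerivAt_eq_zero hd

/-- `scoreDeriv` is 16-Lipschitz, so a shift by at most J/64 lowers its average by at most J/4,
leaving it above J/4. -/
lemma strictAntiOn_sum_score_sub {J : ℝ} (hn : 1 ≤ n) (hJ : 0 < J) {x : Fin n → ℝ}
    (hx : n * (J / 2) < ∑ i, scoreDeriv (x i)) :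
    StrictAntiOn (fun t => ∑ i, score (x i - t)) (Set.Icc (-(J / 64)) (J / 64)) := by
  refine strictAntiOn_of_deriv_neg (convex_Icc _ _)
    (fun t _ => (hasDerivAt_sum_score_sub x t).continuousAt.continuousWithinAt) fun t ht => ?_
  rw [(hasDerivAt_sum_score_sub x t).deriv, neg_lt_zero]
  have ht' : |t| ≤ J / 64 := abs_le.2 (Set.mem_Icc.1 (interior_subset ht))
  have h1 : ∑ i, (scoreDeriv (x i) - 16 * |t|) ≤ ∑ i, scoreDeriv (x i - t) := by
    refine Finset.sum_le_sum fun i _ => ?_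
    have := (abs_le.1 (abs_scoreDeriv_add_sub_le (x i) (-t))).1
    rw [abs_neg, ← sub_eq_add_neg] at this
    linarith
  rw [Finset.sum_sub_distrib] at h1
  simp only [Finset.sum_const, Finset.card_univ, Fintype.card_fin, nsmul_eq_mul] at h1
  have hn0 : (0 : ℝ) < n := by exact_mod_cast hn
  have : (n : ℝ) * (16 * |t|) ≤ n * (J / 4) := by gcongr; linarith
  have : 0 < n * J := by positivity
  linarith

end Deterministic

/-! ### Exponential consistency of the estimator -/

/-- The law of `n` independent observations from the Pearson Type VII distribution with location
`0` and scale `1`. -/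
noncomputable abbrev sampleLaw (m : ℝ) (n : ℕ) : Measure (Fin n → ℝ) :=
  Measure.pi fun _ => pviiMeasure m 0 1

/-- The samples for which some `t ∈ s` fits at least as well as the true location `0`. -/
def betterFit (n : ℕ) (s : Set ℝ) : Set (Fin n → ℝ) :=
  {x | ∃ t ∈ s, ∑ i, logLoss (x i - t) ≤ ∑ i, logLoss (x i)}

section Consistency

variable {m : ℝ}

lemma expSmall_sum_scoreDeriv (hm : 1 / 2 < m) :
    ExpSmall fun n => (sampleLaw m n).real
      {x | ∑ i, scoreDeriv (x i) ≤ n * ((2 * m - 1) / (m + 1) / 2)} := by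
  have := isProbabilityMeasure_pviiMeasure hm 0
  have hJ : 0 < (2 * m - 1) / (m + 1) := div_pos (by linarith) (by linarith)
  obtain ⟨c, hc, h⟩ := exists_measureReal_pi_sum_le_exp (ν := pviiMeasure m 0 1)
    continuous_scoreDeriv.measurable abs_scoreDeriv_le
    (a := (2 * m - 1) / (m + 1) / 2) (by rw [integral_scoreDeriv hm]; linarith)
  exact ⟨1, c, zero_le_one, hc, fun n _ => by rw [one_mul]; exact h n⟩

/-- By Gibbs the mean excess loss E at t is positive. The loss is 1-Lipschitz, so a better fit
within E/2 of t forces the empirical excess at t down to E/2, a large deviation. -/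
lemma exists_nhds_expSmall_betterFit (hm : 1 / 2 < m) {t : ℝ} (ht : t ≠ 0) :
    ∃ s ∈ 𝓝 t, ExpSmall fun n => (sampleLaw m n).real (betterFit n s) := by
  have := isProbabilityMeasure_pviiMeasure hm 0
  have hpos := integral_logLoss_sub_sub_pos hm ht
  set E := ∫ x, (logLoss (x - t) - logLoss x) ∂pviiMeasure m 0 1
  have hl := continuous_logLoss
  obtain ⟨c, hc, h⟩ := exists_measureReal_pi_sum_le_exp (ν := pviiMeasure m 0 1)
    (φ := fun x => logLoss (x - t) - logLoss x) (by fun_prop)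
    (abs_logLoss_sub_sub_le · t) (a := E / 2) (by linarith)
  refine ⟨Metric.ball t (E / 2), Metric.ball_mem_nhds t (by linarith), 1, c, zero_le_one, hc,
    fun n _ => ?_⟩
  rw [one_mul]
  refine le_trans (measureReal_mono fun x hx => ?_) (h n)
  obtain ⟨t', ht', hx⟩ := hx
  have h1 : ∑ i, logLoss (x i - t) ≤ ∑ i, (logLoss (x i - t') + E / 2) := by
    refine Finset.sum_le_sum fun i _ => ?_
    have h2 := (abs_le.1 (abs_logLoss_add_sub_le (x i - t) (t - t'))).1
    rw [Metric.mem_ball, dist_comm, Real.dist_eq] at ht'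
    rw [sub_add_sub_cancel] at h2
    linarith
  rw [Finset.sum_add_distrib] at h1
  simp only [Finset.sum_const, Finset.card_univ, Fintype.card_fin, nsmul_eq_mul] at h1
  simp only [Set.mem_ofPred_eq, Finset.sum_sub_distrib]
  linarith

lemma expSmall_betterFit_of_isCompact (hm : 1 / 2 < m) {K : Set ℝ} (hK : IsCompact K)
    (h0 : (0 : ℝ) ∉ K) : ExpSmall fun n => (sampleLaw m n).real (betterFit n K) := by
  have := isProbabilityMeasure_pviiMeasure hm 0
  refine hK.induction_on (p := fun s => ExpSmall fun n => (sampleLaw m n).real (betterFit n s))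
    ?_ ?_ ?_ ?_
  · exact ⟨0, 1, le_rfl, one_pos, fun n _ => by simp [betterFit]⟩
  · exact fun s t hst ht => ht.mono fun n _ => measureReal_mono
      fun x ⟨u, hu, hx⟩ => ⟨u, hst hu, hx⟩
  · refine fun s t hs ht => (hs.add ht).mono fun n _ => ?_
    refine (measureReal_mono ?_).trans (measureReal_union_le _ _)
    rintro x ⟨u, hu | hu, hx⟩
    exacts [Or.inl ⟨u, hu, hx⟩, Or.inr ⟨u, hu, hx⟩]
  · intro t ht
    obtain ⟨s, hs, h⟩ := exists_nhds_expSmall_betterFit hm (t := t) fun h => h0 (h ▸ ht)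
    exact ⟨s, mem_nhdsWithin_of_mem_nhds hs, h⟩

/-- By `logLoss_add_le`, a good fit at a remote t forces 2 ∑ `logLoss` (xᵢ) to be at least
n(`logLoss` t - log 2). A small exponential moment of the loss makes this unlikely, uniformly in t.
-/
lemma exists_expSmall_betterFit_compl (hm : 1 / 2 < m) :
    ∃ R : ℝ, ExpSmall fun n => (sampleLaw m n).real (betterFit n {t | R ≤ |t|}) := by
  have := isProbabilityMeasure_pviiMeasure hm 0
  -- Keeps m - 2s above 1/2, so that exp (2s `logLoss`) is integrable.
  set s := (m - 1 / 2) / 4 with hs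
  have hs0 : 0 < s := by rw [hs]; linarith
  have hint : Integrable (fun x => Real.exp (2 * s * logLoss x)) (pviiMeasure m 0 1) := by
    rw [pviiMeasure, integrable_withDensity_iff_integrable_smul'
      (continuous_pviiPDF_one m 0).measurable.ennreal_ofReal (by simp)]
    have h := (integrable_one_add_sq_rpow_neg (k := m - 2 * s) (by rw [hs]; linarith)).const_mul
      (pviiConst m)
    refine h.congr (ae_of_all _ fun x => ?_)
    simp only [ENNReal.toReal_ofReal (pviiPDF_one_pos hm 0 x).le, smul_eq_mul]
    rw [pviiPDF_one_eq_exp, mul_assoc, ← Real.exp_add, Real.rpow_def_of_pos (by positivity),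
      sub_zero, logLoss]
    congr 2
    ring
  set D := ∫ x, Real.exp (2 * s * logLoss x) ∂pviiMeasure m 0 1 with hD
  -- Chosen so that D exp (-s(M - log 2)) ≤ exp (-1).
  set M := Real.log 2 + (|Real.log D| + 1) / s with hM
  have hM0 : 0 ≤ M := by
    have := Real.log_nonneg (x := 2) (by norm_num)
    positivity
  have hR : ∀ t : ℝ, Real.exp M ≤ |t| → M ≤ logLoss t := fun t ht => by
    rw [logLoss, Real.le_log_iff_exp_le (by positivity)]
    have h1 := Real.one_le_exp hM0
    rw [← sq_abs]
    nlinarith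
  refine ⟨Real.exp M, 1, 1, zero_le_one, one_pos, fun n hn => ?_⟩
  have hn0 : (0 : ℝ) < n := by exact_mod_cast hn
  have h1 : (fun x => Real.exp (2 * s * logLoss x - s * (M - Real.log 2))) =
      fun x => Real.exp (2 * s * logLoss x) * Real.exp (-(s * (M - Real.log 2))) := by
    ext x; rw [← Real.exp_add, sub_eq_add_neg]
  have hint2 : Integrable (fun x => Real.exp (2 * s * logLoss x - s * (M - Real.log 2)))
      (pviiMeasure m 0 1) := by
    rw [h1]; exact hint.mul_const _
  calc _ ≤ (sampleLaw m n).real {x | 0 ≤ ∑ i, (2 * s * logLoss (x i) - s * (M - Real.log 2))} := by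
        refine measureReal_mono ?_
        rintro x ⟨t, ht, hx⟩
        have h2 := hR t ht
        have h3 : ∑ i, (logLoss t - Real.log 2 - logLoss (x i)) ≤ ∑ i, logLoss (x i - t) := by
          refine Finset.sum_le_sum fun i _ => ?_
          have := logLoss_add_le (x i) (t - x i)
          rw [add_sub_cancel, ← logLoss_neg (t - x i), neg_sub] at this
          linarith
        simp only [Finset.sum_sub_distrib, Finset.sum_const, Finset.card_univ, Fintype.card_fin,
          nsmul_eq_mul] at h3
        simp only [Set.mem_ofPred_eq, Finset.sum_sub_distrib, Finset.sum_const, Finset.card_univ,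
          Fintype.card_fin, nsmul_eq_mul, ← Finset.mul_sum]
        have h4 : (n : ℝ) * M ≤ n * logLoss t := by gcongr
        have h5 : 0 ≤ s * (2 * ∑ i, logLoss (x i) - n * (M - Real.log 2)) :=
          mul_nonneg hs0.le (by linarith)
        linarith
    _ ≤ _ := measureReal_pi_sum_nonneg_le hint2 n
    _ ≤ Real.exp (-1) ^ n := by
        refine pow_le_pow_left₀ (integral_nonneg fun x => (Real.exp_pos _).le) ?_ n
        rw [h1, integral_mul_const]
        have hDpos : 0 < D := integral_exp_pos hint
        have h2 : s * (M - Real.log 2) = |Real.log D| + 1 := by rw [hM]; field_simp; ring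
        rw [h2]
        change D * _ ≤ _
        calc _ = Real.exp (Real.log D + -(|Real.log D| + 1)) := by rw [Real.exp_add, Real.exp_log hDpos]
          _ ≤ _ := Real.exp_le_exp.2 (by linarith [le_abs_self (Real.log D)])
    _ = _ := by rw [← Real.exp_nat_mul]; simp

lemma expSmall_abs_mle_gt (hm : 1 / 2 < m) {g : (n : ℕ) → (Fin n → ℝ) → ℝ}
    (hg : ∀ n, 1 ≤ n → IsPviiMLE m n (g n)) {δ : ℝ} (hδ : 0 < δ) :
    ExpSmall fun n => (sampleLaw m n).real {x | δ < |g n x|} := by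
  have := isProbabilityMeasure_pviiMeasure hm 0
  obtain ⟨R, hR⟩ := exists_expSmall_betterFit_compl hm
  have hK : IsCompact (Metric.closedBall (0 : ℝ) R \ Metric.ball 0 δ) :=
    (isCompact_closedBall 0 R).diff Metric.isOpen_ball
  have h := expSmall_betterFit_of_isCompact hm hK fun h => h.2 (Metric.mem_ball_self hδ)
  refine (h.add hR).mono fun n hn => (measureReal_mono fun x hx => ?_).trans
    (measureReal_union_le _ _)
  have hmin : ∑ i, logLoss (x i - g n x) ≤ ∑ i, logLoss (x i) := by
    simpa using (hg n hn).sum_logLoss_le hm x 0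
  rcases le_total R |g n x| with h1 | h1
  · exact Or.inr ⟨g n x, h1, hmin⟩
  · refine Or.inl ⟨g n x, ⟨by simpa using h1, ?_⟩, hmin⟩
    have hx : δ < |g n x| := hx
    simpa using hx.le

end Consistency

/-! ### Two-sided deviation bounds -/

section Deviations

variable {m : ℝ}

/-- Expansion to second order in r. The cubic constants come from the Taylor remainder of `score`
(16m), from replacing `score` (x - r)² by `score` x² (2m²), and from the exponential remainder (m³).
-/
lemma exp_mul_score_sub_le {m r : ℝ} (hm : 0 ≤ m) (hr : m * |r| ≤ 1) (x : ℝ) :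
    Real.exp (m * r * score (x - r)) ≤ 1 + m * r * score x - m * r ^ 2 * scoreDeriv x +
      m ^ 2 * r ^ 2 / 2 * score x ^ 2 + (16 * m + 2 * m ^ 2 + m ^ 3) * |r| ^ 3 := by
  set u := m * r * score (x - r) with hu
  have hur : |u| ≤ m * |r| := by
    rw [hu, abs_mul, abs_mul, abs_of_nonneg hm]
    exact mul_le_of_le_one_right (by positivity) (abs_score_le _)
  have h1 : Real.exp u ≤ 1 + u + u ^ 2 / 2 + |u| ^ 3 := by
    have h := (abs_le.1 (Real.exp_bound (hur.trans hr) (n := 3) (by norm_num))).2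
    norm_num [Finset.sum_range_succ, Nat.factorial] at h
    have : 0 ≤ |u| ^ 3 := by positivity
    linarith
  have h2 : u ≤ m * r * score x - m * r ^ 2 * scoreDeriv x + 16 * m * |r| ^ 3 := by
    have h := abs_score_add_sub_sub_le x (-r)
    rw [← sub_eq_add_neg, neg_sq, ← sq_abs r] at h
    have h3 : |m * r * (score (x - r) - score x - -r * scoreDeriv x)| ≤ m * |r| * (16 * |r| ^ 2) := by
      rw [abs_mul, abs_mul, abs_of_nonneg hm]
      gcongr
    have := (abs_le.1 h3).2
    rw [hu]
    linarith
  have h3 : u ^ 2 / 2 ≤ m ^ 2 * r ^ 2 / 2 * score x ^ 2 + 2 * m ^ 2 * |r| ^ 3 := by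
    have h4 : |score (x - r) - score x| ≤ 2 * |r| := by
      simpa [sub_eq_add_neg] using abs_sub_le_of_hasDerivAt_of_abs_le hasDerivAt_score (x := x)
        (r := -r) (C := 2) fun u _ => abs_scoreDeriv_le u
    have h5 : |score (x - r) + score x| ≤ 2 :=
      (abs_add_le _ _).trans (by linarith [abs_score_le (x - r), abs_score_le x])
    have h6 : score (x - r) ^ 2 - score x ^ 2 ≤ 4 * |r| := by
      rw [sq_sub_sq]
      refine (le_abs_self _).trans ?_
      rw [abs_mul]
      calc _ ≤ 2 * (2 * |r|) := by gcongr
        _ = _ := by ring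
    have h7 : m ^ 2 * r ^ 2 / 2 * (score (x - r) ^ 2 - score x ^ 2) ≤ m ^ 2 * r ^ 2 / 2 * (4 * |r|) := by
      gcongr
    have h8 : m ^ 2 * r ^ 2 / 2 * (4 * |r|) = 2 * m ^ 2 * |r| ^ 3 := by rw [← sq_abs r]; ring
    rw [hu, mul_pow, mul_pow]
    linarith
  have h4 : |u| ^ 3 ≤ m ^ 3 * |r| ^ 3 := by rw [← mul_pow]; gcongr
  linarith

/-- The quadratic terms average to -mJr² + (m²/2)(J/m)r² = -mJr²/2. The tilt mr is optimal, as λ = m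
minimizes -λJ + λ²J/(2m). -/
lemma integral_exp_mul_score_sub_le (hm : 1 / 2 < m) {r : ℝ} (hr : m * |r| ≤ 1) :
    ∫ x, Real.exp (m * r * score (x - r)) ∂pviiMeasure m 0 1 ≤
      Real.exp (-(m * ((2 * m - 1) / (m + 1)) / 2 * r ^ 2) +
        (16 * m + 2 * m ^ 2 + m ^ 3) * |r| ^ 3) := by
  have := isProbabilityMeasure_pviiMeasure hm 0
  set ν := pviiMeasure m 0 1
  set J := (2 * m - 1) / (m + 1) with hJ
  have hsc := continuous_score
  have i0 : Integrable (fun x => Real.exp (m * r * score (x - r))) ν := by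
    refine integrable_of_continuous_of_abs_le (b := Real.exp 1) (by fun_prop) fun x => ?_
    rw [Real.abs_exp, Real.exp_le_exp]
    refine (le_abs_self _).trans ?_
    rw [abs_mul, abs_mul, abs_of_nonneg (by linarith : 0 ≤ m)]
    exact (mul_le_of_le_one_right (mul_nonneg (by linarith) (abs_nonneg _)) (abs_score_le _)).trans hr
  have i1 : Integrable (fun x => 1 + m * r * score x) ν :=
    (integrable_const 1).add (integrable_score.const_mul _)
  have i2 : Integrable (fun x => 1 + m * r * score x - m * r ^ 2 * scoreDeriv x) ν :=
    i1.sub (integrable_scoreDeriv.const_mul _)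
  have i3 : Integrable (fun x => 1 + m * r * score x - m * r ^ 2 * scoreDeriv x +
      m ^ 2 * r ^ 2 / 2 * score x ^ 2) ν := i2.add (integrable_score_sq.const_mul _)
  have h := integral_mono i0 (i3.add (integrable_const ((16 * m + 2 * m ^ 2 + m ^ 3) * |r| ^ 3)))
    (exp_mul_score_sub_le (by linarith) hr)
  simp only [Pi.add_apply] at h
  rw [integral_add i3 (integrable_const _), integral_add i2 (integrable_score_sq.const_mul _),
    integral_sub i1 (integrable_scoreDeriv.const_mul _),
    integral_add (integrable_const _) (integrable_score.const_mul _), integral_const_mul,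
    integral_const_mul, integral_const_mul, integral_score hm, integral_score_sq hm,
    integral_scoreDeriv hm, ← hJ] at h
  simp only [integral_const, probReal_univ, smul_eq_mul, one_mul, mul_zero, add_zero] at h
  refine h.trans (le_trans (le_of_eq ?_) (Real.add_one_le_exp _))
  have : m ≠ 0 := by linarith
  field_simp
  ring

lemma exists_measureReal_abs_mle_gt_le (hm : 1 / 2 < m) {g : (n : ℕ) → (Fin n → ℝ) → ℝ}
    (hg : ∀ n, 1 ≤ n → IsPviiMLE m n (g n)) {η : ℝ} (hη : 0 < η) :
    ∃ r₀ A c : ℝ, 0 < r₀ ∧ 0 ≤ A ∧ 0 < c ∧ ∀ n : ℕ, 1 ≤ n → ∀ r, 0 < r → r ≤ r₀ →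
      (sampleLaw m n).real {x | r < |g n x|} ≤
        2 * Real.exp (-(n * r ^ 2 * (m * ((2 * m - 1) / (m + 1)) / 2 - η))) +
          A * Real.exp (-(c * n)) := by
  have := isProbabilityMeasure_pviiMeasure hm 0
  have hm0 : 0 < m := by linarith
  set J := (2 * m - 1) / (m + 1) with hJ
  have hJ0 : 0 < J := div_pos (by linarith) (by linarith)
  set C := 16 * m + 2 * m ^ 2 + m ^ 3 with hC
  have hC0 : 0 < C := by positivity
  obtain ⟨A, c, hA, hc, hbad⟩ :=
    (expSmall_sum_scoreDeriv hm).add (expSmall_abs_mle_gt hm hg (δ := J / 64) (by positivity))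
  -- The three caps on r serve monotonicity of the score sum, a tilted exponent of size at most 1,
  -- and absorption of the cubic error into η.
  refine ⟨min (J / 64) (min (1 / m) (η / C)), A, c, by positivity, hA, hc, fun n hn r hr hr' => ?_⟩
  have hrJ : r ≤ J / 64 := hr'.trans (min_le_left _ _)
  have hrm : m * r ≤ 1 := by
    have := hr'.trans ((min_le_right _ _).trans (min_le_left _ _))
    rwa [le_div_iff₀' hm0] at this
  have hrC : C * r ≤ η := by
    have := hr'.trans ((min_le_right _ _).trans (min_le_right _ _))
    rwa [le_div_iff₀' hC0] at this
  have hsc := continuous_score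
  have chern (r' : ℝ) (h : |r'| = r) :
      (sampleLaw m n).real {x | 0 ≤ ∑ i, m * r' * score (x i - r')} ≤
        Real.exp (-(n * r ^ 2 * (m * J / 2 - η))) := by
    have hint : Integrable (fun x => Real.exp (m * r' * score (x - r'))) (pviiMeasure m 0 1) := by
      refine integrable_of_continuous_of_abs_le (b := Real.exp 1) (by fun_prop) fun x => ?_
      rw [Real.abs_exp, Real.exp_le_exp]
      refine (le_abs_self _).trans ?_
      rw [abs_mul, abs_mul, abs_of_pos hm0, h]
      exact (mul_le_of_le_one_right (by positivity) (abs_score_le _)).trans hrm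
    refine (measureReal_pi_sum_nonneg_le hint n).trans ?_
    refine (pow_le_pow_left₀ (integral_nonneg fun x => (Real.exp_pos _).le)
      (integral_exp_mul_score_sub_le hm (by rw [h]; exact hrm)) n).trans ?_
    rw [← Real.exp_nat_mul, Real.exp_le_exp, h, ← sq_abs r', h, ← hJ, ← hC]
    have h1 : (n : ℝ) * r ^ 2 * (C * r) ≤ n * r ^ 2 * η := by gcongr
    linarith
  -- Off the two rare events the score sum decreases strictly and vanishes at the estimator. An
  -- estimate beyond r makes it positive at r; one below -r makes it negative at -r.
  have hsub : {x | r < |g n x|} ⊆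
      ({x | 0 ≤ ∑ i, m * r * score (x i - r)} ∪ {x | 0 ≤ ∑ i, m * (-r) * score (x i - -r)}) ∪
      ({x | ∑ i, scoreDeriv (x i) ≤ n * (J / 2)} ∪ {x | J / 64 < |g n x|}) := by
    intro x hx
    by_contra hcon
    simp only [Set.mem_union, Set.mem_ofPred_eq, not_or, not_le, not_lt] at hcon hx
    obtain ⟨⟨h1, h2⟩, h3, h4⟩ := hcon
    have hanti := strictAntiOn_sum_score_sub hn hJ0 h3
    have h0 := (hg n hn).sum_score_eq_zero hm x
    have hgm := Set.mem_Icc.2 (abs_le.1 h4)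
    rw [← Finset.mul_sum] at h1 h2
    rcases lt_abs.1 hx with h | h
    · have h5 := hanti (Set.mem_Icc.2 ⟨by linarith, hrJ⟩) hgm h
      simp only [h0] at h5
      have := mul_pos (mul_pos hm0 hr) h5
      linarith
    · have h5 := hanti hgm (Set.mem_Icc.2 ⟨by linarith, by linarith⟩) (show g n x < -r by linarith)
      simp only [h0] at h5
      have := mul_pos_of_neg_of_neg (by nlinarith : m * -r < 0) h5
      linarith
  refine (measureReal_mono hsub).trans ((measureReal_union_le _ _).trans ?_)
  refine add_le_add ((measureReal_union_le _ _).trans ?_)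
    ((measureReal_union_le _ _).trans (hbad n hn))
  rw [two_mul]
  exact add_le_add (chern r (abs_of_pos hr)) (chern (-r) (by rw [abs_neg, abs_of_pos hr]))

/-- Under location `s`, the score at a smaller location is positive and the log-likelihood ratio
is close to its mean with probability at least `1 / 2`. -/
lemma exists_half_le_measureReal_pi_shift (hm : 1 / 2 < m) {κ η : ℝ} (hκ : 0 < κ) (hκ1 : κ ≤ 1)
    (hη : 0 < η) :
    ∃ N₀ : ℝ, ∀ n : ℕ, 1 ≤ n → ∀ r, 0 < r → r ≤ (2 * m - 1) / (m + 1) / 64 → N₀ ≤ n * r ^ 2 →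
      1 / 2 ≤ (Measure.pi fun _ : Fin n => pviiMeasure m ((1 + κ) * r) 1).real
        {x | 0 < ∑ i, score (x i - r) ∧
          ∑ i, m * (logLoss (x i) - logLoss (x i - (1 + κ) * r)) ≤
            n * (m * (((1 + κ) * r) ^ 2 / 2 * ((2 * m - 1) / (m + 1)) + 16 * ((1 + κ) * r) ^ 3)
              + η * r ^ 2)} := by
  have hm0 : 0 < m := by linarith
  set J := (2 * m - 1) / (m + 1) with hJ
  have hJ0 : 0 < J := div_pos (by linarith) (by linarith)
  -- Each threshold makes one Chebyshev probability at most 1/4. Both probabilities scale as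
  -- 1/(nr²), since the log-likelihood ratio is bounded by 2mr.
  refine ⟨max (16 / (κ * J) ^ 2) (16 * m ^ 2 / η ^ 2), fun n hn r hr hrJ hN => ?_⟩
  set s := (1 + κ) * r with hs
  have hs0 : 0 < s := by positivity
  have hs2 : s ≤ 2 * r := by rw [hs]; gcongr; linarith
  have := isProbabilityMeasure_pviiMeasure hm 0
  have := isProbabilityMeasure_pviiMeasure hm s
  set ν := pviiMeasure m 0 1 with hν
  set Q := Measure.pi fun _ : Fin n => pviiMeasure m s 1 with hQ
  have hn0 : (0 : ℝ) < n := by exact_mod_cast hn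
  have hl := continuous_logLoss
  have hsc := continuous_score
  -- After recentering, the score is evaluated at x + κr, with mean at least κrJ - 16(κr)². The cap
  -- r ≤ J/64 makes the error at most half of the main term.
  have hmean1 : κ * r * J / 2 ≤ ∫ x, score (x - r) ∂pviiMeasure m s 1 := by
    rw [integral_pviiMeasure_eq_comp_add hm]
    have h : ∀ x, score x + κ * r * scoreDeriv x - 16 * (κ * r) ^ 2 ≤ score (x + s - r) := fun x => by
      have h := (abs_le.1 (abs_score_add_sub_sub_le x (κ * r))).1
      rw [show x + s - r = x + κ * r by rw [hs]; ring]
      linarith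
    have i1 : Integrable (fun x => score x + κ * r * scoreDeriv x) ν :=
      integrable_score.add (integrable_scoreDeriv.const_mul _)
    have h2 := integral_mono (μ := ν) (i1.sub (integrable_const (16 * (κ * r) ^ 2)))
      (integrable_of_continuous_of_abs_le (φ := fun x => score (x + s - r)) (b := 1) (by fun_prop)
        fun x => abs_score_le _) h
    simp only [Pi.sub_apply] at h2
    rw [integral_sub i1 (integrable_const _),
      integral_add integrable_score (integrable_scoreDeriv.const_mul _), integral_const_mul,
      integral_score hm, integral_scoreDeriv hm, ← hJ] at h2
    simp only [integral_const, probReal_univ, smul_eq_mul, one_mul, zero_add] at h2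
    have h3 : κ * r * (16 * (κ * r)) ≤ κ * r * (J / 2) := by
      gcongr
      have : κ * r ≤ 1 * r := by gcongr
      linarith
    linarith
  have hmean2 : ∫ x, m * (logLoss x - logLoss (x - s)) ∂pviiMeasure m s 1 ≤
      m * (s ^ 2 / 2 * J + 16 * s ^ 3) := by
    rw [integral_pviiMeasure_eq_comp_add hm, integral_const_mul]
    simp only [add_sub_cancel_right]
    gcongr
    have h : ∀ x, logLoss (x + s) - logLoss x ≤ s * score x + s ^ 2 / 2 * scoreDeriv x + 16 * s ^ 3 :=
      fun x => by
        have h := (abs_le.1 (abs_logLoss_add_sub_sub_le x s)).2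
        rw [abs_of_pos hs0] at h
        linarith
    have i1 : Integrable (fun x => s * score x + s ^ 2 / 2 * scoreDeriv x) ν :=
      (integrable_score.const_mul _).add (integrable_scoreDeriv.const_mul _)
    have h2 := integral_mono (μ := ν)
      (integrable_of_continuous_of_abs_le (φ := fun x => logLoss (x + s) - logLoss x) (b := |s|)
        (by fun_prop) fun x => abs_logLoss_add_sub_le x s)
      (i1.add (integrable_const (16 * s ^ 3))) h
    simp only [Pi.add_apply] at h2
    rw [integral_add i1 (integrable_const _),
      integral_add (integrable_score.const_mul _) (integrable_scoreDeriv.const_mul _),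
      integral_const_mul, integral_const_mul, integral_score hm, integral_scoreDeriv hm, ← hJ] at h2
    simpa using h2
  have c1 := measureReal_pi_abs_sum_sub_ge_le (ν := pviiMeasure m s 1) (φ := fun x => score (x - r))
    (by fun_prop) (fun x => abs_score_le _) (a := κ * r * J / 2) (by positivity) hn
  have c2 := measureReal_pi_abs_sum_sub_ge_le (ν := pviiMeasure m s 1)
    (φ := fun x => m * (logLoss x - logLoss (x - s))) (b := m * (2 * r))
    (by fun_prop) (fun x => by
      rw [abs_mul, abs_of_pos hm0, abs_sub_comm]
      gcongr
      refine (abs_logLoss_sub_sub_le x s).trans ?_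
      rwa [abs_of_pos hs0]) (a := η * r ^ 2) (by positivity) hn
  have b1 : 1 ^ 2 / (n * (κ * r * J / 2) ^ 2) ≤ (1 / 4 : ℝ) := by
    have h := (le_max_left _ _).trans hN
    rw [div_le_iff₀ (by positivity)] at h
    rw [div_le_div_iff₀ (by positivity) (by norm_num)]
    linarith
  have b2 : (m * (2 * r)) ^ 2 / (n * (η * r ^ 2) ^ 2) ≤ 1 / 4 := by
    have h := (le_max_right _ _).trans hN
    rw [div_le_iff₀ (by positivity)] at h
    rw [div_le_div_iff₀ (by positivity) (by norm_num)]
    have := mul_le_mul_of_nonneg_right h (sq_nonneg r)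
    linarith
  set S := {x : Fin n → ℝ | 0 < ∑ i, score (x i - r) ∧
    ∑ i, m * (logLoss (x i) - logLoss (x i - s)) ≤
      n * (m * (s ^ 2 / 2 * J + 16 * s ^ 3) + η * r ^ 2)} with hS
  have hcover : (Set.univ : Set (Fin n → ℝ)) ⊆ S ∪
      ({x | n * (κ * r * J / 2) ≤
          |∑ i, score (x i - r) - n * ∫ x, score (x - r) ∂pviiMeasure m s 1|} ∪
        {x | n * (η * r ^ 2) ≤ |∑ i, m * (logLoss (x i) - logLoss (x i - s)) -
          n * ∫ x, m * (logLoss x - logLoss (x - s)) ∂pviiMeasure m s 1|}) := by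
    intro x _
    by_contra hcon
    simp only [Set.mem_union, Set.mem_ofPred_eq, not_or, not_le, hS] at hcon
    obtain ⟨h0, h1, h2⟩ := hcon
    refine h0 ⟨?_, ?_⟩
    · have := (abs_lt.1 h1).1
      have : (n : ℝ) * (κ * r * J / 2) ≤ n * ∫ x, score (x - r) ∂pviiMeasure m s 1 := by gcongr
      linarith
    · have := (abs_lt.1 h2).2
      have : (n : ℝ) * ∫ x, m * (logLoss x - logLoss (x - s)) ∂pviiMeasure m s 1 ≤
        n * (m * (s ^ 2 / 2 * J + 16 * s ^ 3)) := by gcongr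
      linarith
  have h1 : Q.real Set.univ ≤ _ := (measureReal_mono hcover).trans ((measureReal_union_le _ _).trans
    (add_le_add le_rfl (measureReal_union_le _ _)))
  rw [probReal_univ] at h1
  linarith

lemma exists_le_measureReal_abs_mle_gt (hm : 1 / 2 < m) {g : (n : ℕ) → (Fin n → ℝ) → ℝ}
    (hg : ∀ n, 1 ≤ n → IsPviiMLE m n (g n)) {η : ℝ} (hη : 0 < η) :
    ∃ r₀ N₀ A c : ℝ, 0 < r₀ ∧ 0 ≤ A ∧ 0 < c ∧ ∀ n : ℕ, 1 ≤ n → ∀ r, 0 < r → r ≤ r₀ →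
      N₀ ≤ n * r ^ 2 →
      1 / 2 * Real.exp (-(n * r ^ 2 * (m * ((2 * m - 1) / (m + 1)) / 2 + 4 * η))) ≤
        (sampleLaw m n).real {x | r < |g n x|} + A * Real.exp (-(c * n)) := by
  have hm0 : 0 < m := by linarith
  have := isProbabilityMeasure_pviiMeasure hm 0
  have hshift := fun κ => exists_half_le_measureReal_pi_shift hm (κ := κ) (η := η)
  set J := (2 * m - 1) / (m + 1) with hJ
  have hJ0 : 0 < J := div_pos (by linarith) (by linarith)
  -- The overshoot κ gives the score at r a positive mean, while (1 + κ)² ≤ 1 + 3κ raises the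
  -- likelihood cost by only a multiple of η.
  set κ := min 1 (η / (m * J)) with hκ
  have hκ0 : 0 < κ := by positivity
  have hκ1 : κ ≤ 1 := min_le_left _ _
  have hκη : m * J * κ ≤ η := by
    rw [← le_div_iff₀' (by positivity)]; exact min_le_right _ _
  obtain ⟨N₀, hhalf⟩ := hshift κ hκ0 hκ1 hη
  obtain ⟨A, c, hA, hc, hbad⟩ := expSmall_sum_scoreDeriv hm
  refine ⟨min (J / 64) (η / (128 * m)), N₀, A, c, by positivity, hA, hc,
    fun n hn r hr hr' hN => ?_⟩
  have hrJ : r ≤ J / 64 := hr'.trans (min_le_left _ _)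
  have hrm : 128 * m * r ≤ η := by
    rw [← le_div_iff₀' (by positivity)]; exact hr'.trans (min_le_right _ _)
  have hhalf := hhalf n hn r hr hrJ hN
  set s := (1 + κ) * r with hs
  set L := m * (s ^ 2 / 2 * J + 16 * s ^ 3) + η * r ^ 2 with hL
  set S := {x : Fin n → ℝ | 0 < ∑ i, score (x i - r) ∧
    ∑ i, m * (logLoss (x i) - logLoss (x i - s)) ≤ n * L} with hS
  have hl := continuous_logLoss
  have hsc := continuous_score
  have hn0 : (0 : ℝ) < n := by exact_mod_cast hn
  have hSc1 : Continuous fun x : Fin n → ℝ => ∑ i, score (x i - r) := by fun_prop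
  have hSc2 : Continuous fun x : Fin n → ℝ => ∑ i, m * (logLoss (x i) - logLoss (x i - s)) := by
    fun_prop
  have hSm : MeasurableSet S := (isOpen_lt continuous_const hSc1).measurableSet.inter
    (isClosed_le hSc2 continuous_const).measurableSet
  have := isProbabilityMeasure_pviiMeasure hm s
  rw [pviiMeasure_eq_withDensity hm] at this hhalf
  have hchange := measureReal_pi_withDensity_le (ν := pviiMeasure m 0 1)
    (w := fun x => m * (logLoss x - logLoss (x - s))) (by fun_prop) hSm (L := n * L) fun x hx => hx.2
  -- Consistency is not needed here: an estimate with |g| ≤ r is already in the monotonicity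
  -- interval, so the score sum at r would be at most 0.
  have hsub : S ⊆ {x | r < |g n x|} ∪ {x | ∑ i, scoreDeriv (x i) ≤ n * (J / 2)} := by
    intro x hx
    by_contra hcon
    simp only [Set.mem_union, Set.mem_ofPred_eq, not_or, not_lt, not_le] at hcon
    obtain ⟨h1, h2⟩ := hcon
    have hgr := abs_le.1 h1
    have h3 := (strictAntiOn_sum_score_sub hn hJ0 h2).antitoneOn
      (Set.mem_Icc.2 ⟨by linarith, by linarith⟩ : g n x ∈ _)
      (Set.mem_Icc.2 ⟨by linarith, hrJ⟩) hgr.2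
    simp only [(hg n hn).sum_score_eq_zero hm x] at h3
    have := hx.1
    linarith
  have hP : (sampleLaw m n).real S ≤ (sampleLaw m n).real {x | r < |g n x|} +
      A * Real.exp (-(c * n)) :=
    (measureReal_mono hsub).trans ((measureReal_union_le _ _).trans
      (add_le_add le_rfl (hbad n hn)))
  have hLr : L ≤ r ^ 2 * (m * J / 2 + 4 * η) := by
    have h1 : s ^ 2 ≤ r ^ 2 * (1 + 3 * κ) := by
      rw [hs, mul_pow, mul_comm]
      gcongr
      nlinarith
    have h2 : s ^ 3 ≤ 8 * r ^ 3 := by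
      have : s ≤ 2 * r := by rw [hs]; gcongr; linarith
      calc s ^ 3 ≤ (2 * r) ^ 3 := by gcongr
        _ = _ := by ring
    calc L ≤ m * (r ^ 2 * (1 + 3 * κ) / 2 * J + 16 * (8 * r ^ 3)) + η * r ^ 2 := by
          rw [hL]; gcongr
      _ = r ^ 2 * (m * J / 2 + 3 / 2 * (m * J * κ) + 128 * m * r + η) := by ring
      _ ≤ r ^ 2 * (m * J / 2 + 3 / 2 * η + η + η) := by gcongr
      _ ≤ _ := by gcongr ?_ * ?_; linarith
  refine le_trans ?_ hP
  calc _ ≤ 1 / 2 * Real.exp (-(n * L)) := by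
        rw [mul_assoc (n : ℝ)]
        gcongr
    _ ≤ (Real.exp (n * L) * (sampleLaw m n).real S) * Real.exp (-(n * L)) := by
        gcongr
        exact hhalf.trans hchange
    _ = _ := by rw [mul_right_comm, ← Real.exp_add]; simp

/-- Non-asymptotic two-sided estimate from which the large and the moderate deviations follow. -/
lemma exists_measureReal_abs_mle_gt_bounds (hm : 1 / 2 < m) {g : (n : ℕ) → (Fin n → ℝ) → ℝ}
    (hg : ∀ n, 1 ≤ n → IsPviiMLE m n (g n)) {η : ℝ} (hη : 0 < η) :
    ∃ r₀ N₀ : ℝ, 0 < r₀ ∧ ∀ n : ℕ, 1 ≤ n → ∀ r, 0 < r → r ≤ r₀ → N₀ ≤ n * r ^ 2 →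
      Real.exp (-(n * r ^ 2 * (m * (2 * m - 1) / (2 * (m + 1)) + η))) ≤
        (sampleLaw m n).real {x | r < |g n x|} ∧
      (sampleLaw m n).real {x | r < |g n x|} ≤
        Real.exp (-(n * r ^ 2 * (m * (2 * m - 1) / (2 * (m + 1)) - η))) := by
  obtain ⟨r₁, A₁, c₁, hr₁, hA₁, hc₁, hup⟩ :=
    exists_measureReal_abs_mle_gt_le hm hg (η := η / 2) (by positivity)
  obtain ⟨r₂, N₂, A₂, c₂, hr₂, hA₂, hc₂, hlo⟩ :=
    exists_le_measureReal_abs_mle_gt hm hg (η := η / 8) (by positivity)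
  have hI : m * ((2 * m - 1) / (m + 1)) / 2 = m * (2 * m - 1) / (2 * (m + 1)) := by
    rw [mul_div_assoc', div_div, mul_comm (m + 1)]
  rw [hI] at hup hlo
  set I := m * (2 * m - 1) / (2 * (m + 1)) with hIdef
  have hI0 : 0 < I := div_pos (mul_pos (by linarith) (by linarith)) (by linarith)
  have h4 : 4 * (η / 8) = η / 2 := by ring
  rw [h4] at hlo
  -- The caps on r make the fixed-rate terms negligible against exp (-nr²I) (r ≤ 1 gives r² ≤ r).
  -- The thresholds on nr² let the spare factor exp (nr²η/2) absorb the constants 2 + A₁ and 1/4.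
  refine ⟨min (min r₁ r₂) (min 1 (min (c₁ / I) (c₂ / 2 / (I + η / 2)))),
    max N₂ (max (2 * (2 + A₁) / η) (max (8 * A₂ / c₂) (8 / η))), by positivity,
    fun n hn r hr hr' hN => ?_⟩
  simp only [le_min_iff, max_le_iff] at hr' hN
  obtain ⟨⟨hr1, hr2⟩, hr3, hr4, hr5⟩ := hr'
  obtain ⟨hN1, hN2, hN3, hN4⟩ := hN
  have hn0 : (0 : ℝ) < n := by exact_mod_cast hn
  have hrr : r ^ 2 ≤ r := by nlinarith
  have hnr : (n : ℝ) * r ^ 2 ≤ n := by nlinarith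
  have hnr0 : 0 < n * r ^ 2 := by positivity
  rw [le_div_iff₀ (by positivity)] at hr4 hr5
  rw [div_le_iff₀ (by positivity)] at hN2 hN3 hN4
  constructor
  · have h := hlo n hn r hr hr2 hN1
    set E := Real.exp (-(n * r ^ 2 * (I + η / 2))) with hE
    have hE0 : 0 < E := Real.exp_pos _
    have e1 : Real.exp (-(n * r ^ 2 * (I + η))) = Real.exp (-(n * r ^ 2 * η / 2)) * E := by
      rw [hE, ← Real.exp_add]; congr 1; ring
    have e2 : Real.exp (-(c₂ * n)) ≤ Real.exp (-(c₂ * n / 2)) * E := by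
      rw [hE, ← Real.exp_add, Real.exp_le_exp]
      have : (n : ℝ) * (r ^ 2 * (I + η / 2)) ≤ n * (c₂ / 2) := by
        gcongr
        exact le_trans (by gcongr) hr5
      linarith
    have hexp : ∀ y : ℝ, 0 < y → Real.exp (-y) ≤ 1 / y := fun y hy => by
      rw [Real.exp_neg, ← one_div]
      exact one_div_le_one_div_of_le hy (by linarith [Real.add_one_le_exp y])
    have e3 : Real.exp (-(n * r ^ 2 * η / 2)) ≤ 1 / 4 := by
      refine (hexp _ (by positivity)).trans ?_
      exact one_div_le_one_div_of_le (by norm_num) (by linarith)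
    have e4 : A₂ * Real.exp (-(c₂ * n / 2)) ≤ 1 / 4 := by
      have h1 : A₂ * Real.exp (-(c₂ * n / 2)) ≤ A₂ * (1 / (c₂ * n / 2)) := by
        gcongr
        exact hexp _ (by positivity)
      refine h1.trans ?_
      rw [mul_one_div, div_le_div_iff₀ (by positivity) (by norm_num)]
      have : n * r ^ 2 * c₂ ≤ n * c₂ := by gcongr
      linarith
    have e5 : A₂ * Real.exp (-(c₂ * n)) ≤ 1 / 4 * E := by
      calc _ ≤ A₂ * (Real.exp (-(c₂ * n / 2)) * E) := by gcongr
        _ = A₂ * Real.exp (-(c₂ * n / 2)) * E := by ring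
        _ ≤ _ := by gcongr
    have e6 : Real.exp (-(n * r ^ 2 * η / 2)) * E ≤ 1 / 4 * E := by gcongr
    rw [e1]
    linarith
  · refine (hup n hn r hr hr1).trans ?_
    set E := Real.exp (-(n * r ^ 2 * (I - η / 2))) with hE
    have e1 : Real.exp (-(n * r ^ 2 * (I - η))) = Real.exp (n * r ^ 2 * η / 2) * E := by
      rw [hE, ← Real.exp_add]; congr 1; ring
    have e2 : Real.exp (-(c₁ * n)) ≤ E := by
      rw [hE, Real.exp_le_exp]
      have h1 : (n : ℝ) * (r ^ 2 * I) ≤ n * c₁ := by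
        gcongr
        exact le_trans (by gcongr) hr4
      have : 0 < n * r ^ 2 * η := by positivity
      linarith
    have e3 : 2 + A₁ ≤ Real.exp (n * r ^ 2 * η / 2) := by
      have := Real.add_one_le_exp (n * r ^ 2 * η / 2)
      linarith
    rw [e1]
    calc _ ≤ 2 * E + A₁ * E := by gcongr
      _ = (2 + A₁) * E := by ring
      _ ≤ _ := by gcongr

end Deviations

/-! ### Transfer to the given sample and passage to the limit -/

/-- Translating the observations translates a maximum likelihood estimator. -/
lemma IsPviiMLE.comp_add {m : ℝ} {n : ℕ} {g : (Fin n → ℝ) → ℝ} (hg : IsPviiMLE m n g) (θ : ℝ) :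
    IsPviiMLE m n fun x => g (fun i => x i + θ) - θ := by
  refine ⟨(hg.measurable.comp (by fun_prop)).sub_const θ, fun x t => ?_⟩
  have h := hg.maximizes (fun i => x i + θ) (t + θ)
  simp only [pviiLikelihood, add_sub_add_right_eq_sub] at h ⊢
  refine h.trans (le_of_eq (Finset.prod_congr rfl fun i _ => ?_))
  congr 1
  ring

lemma map_sub_eq_sampleLaw {Ω : Type*} [MeasurableSpace Ω] {P : Measure Ω} [IsProbabilityMeasure P]
    {m θ : ℝ} {X : ℕ → Ω → ℝ} (hX : ∀ i, Measurable (X i)) (hindep : iIndepFun X P)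
    (hlaw : ∀ i, P.map (X i) = pviiMeasure m θ 1) (n : ℕ) :
    P.map (fun ω (i : Fin n) => X i ω - θ) = sampleLaw m n := by
  have h := (hindep.precomp (g := fun i : Fin n => (i : ℕ)) Fin.val_injective).comp
    (fun _ x => x - θ) fun _ => by fun_prop
  have h2 := (iIndepFun_iff_map_fun_eq_pi_map
    (fun i : Fin n => ((hX i).sub_const θ).aemeasurable)).1 h
  refine h2.trans ?_
  congr 1
  ext1 i
  change P.map ((fun x => x - θ) ∘ X i) = _
  rw [← Measure.map_map (by fun_prop) (hX i), hlaw, map_sub_pviiMeasure]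

/-- Recentering by θ reduces to `sampleLaw`. The positive lower bound makes the logarithm a real
number, so the remaining limits are essentially real ones. -/
lemma exists_logDevProb_bounds {Ω : Type*} [MeasurableSpace Ω] {P : Measure Ω}
    [IsProbabilityMeasure P] {m θ : ℝ} (hm : 1 / 2 < m)
    {X : ℕ → Ω → ℝ} (hX : ∀ i, Measurable (X i)) (hindep : iIndepFun X P)
    (hlaw : ∀ i, P.map (X i) = pviiMeasure m θ 1)
    {g : (n : ℕ) → (Fin n → ℝ) → ℝ} (hg : ∀ n, 1 ≤ n → IsPviiMLE m n (g n)) {η : ℝ} (hη : 0 < η) :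
    ∃ r₀ N₀ : ℝ, 0 < r₀ ∧ ∀ n : ℕ, 1 ≤ n → ∀ r, 0 < r → r ≤ r₀ → N₀ ≤ n * r ^ 2 →
      ∃ l : ℝ, logDevProb P X g θ n r = l ∧
        -(n * r ^ 2 * (m * (2 * m - 1) / (2 * (m + 1)) + η)) ≤ l ∧
        l ≤ -(n * r ^ 2 * (m * (2 * m - 1) / (2 * (m + 1)) - η)) := by
  have := isProbabilityMeasure_pviiMeasure hm 0
  obtain ⟨r₀, N₀, hr₀, h⟩ := exists_measureReal_abs_mle_gt_bounds hm
    (g := fun n x => g n (fun i => x i + θ) - θ) (fun n hn => (hg n hn).comp_add θ) hη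
  refine ⟨r₀, N₀, hr₀, fun n hn r hr hr' hN => ?_⟩
  obtain ⟨h1, h2⟩ := h n hn r hr hr' hN
  set p := (sampleLaw m n).real {x | r < |g n (fun i => x i + θ) - θ|} with hp
  have hp0 : 0 < p := (Real.exp_pos _).trans_le h1
  refine ⟨Real.log p, ?_, (Real.le_log_iff_exp_le hp0).2 h1, (Real.log_le_iff_le_exp hp0).2 h2⟩
  have hmeas : MeasurableSet {x : Fin n → ℝ | r < |g n (fun i => x i + θ) - θ|} :=
    measurableSet_lt measurable_const ((hg n hn).comp_add θ).measurable.abs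
  have hY : Measurable fun ω (i : Fin n) => X i ω - θ :=
    measurable_pi_lambda _ fun i => (hX i).sub_const θ
  have hPp : P {ω | r < |g n (fun i => X i ω) - θ|} = ENNReal.ofReal p := by
    rw [hp, ofReal_measureReal, ← map_sub_eq_sampleLaw hX hindep hlaw n, Measure.map_apply hY hmeas]
    simp
  rw [logDevProb, hPp, ENNReal.log_ofReal_of_pos hp0]

theorem theorem1p4 {Ω : Type*} [MeasurableSpace Ω] (P : Measure Ω) [IsProbabilityMeasure P]
    (m θ : ℝ) (hm : 1 / 2 < m)
    (X : ℕ → Ω → ℝ) (hX : ∀ i, Measurable (X i)) (hindep : iIndepFun X P)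
    (hlaw : ∀ i, P.map (X i) = pviiMeasure m θ 1)
    (g : (n : ℕ) → (Fin n → ℝ) → ℝ) (hg : ∀ n, 1 ≤ n → IsPviiMLE m n (g n)) :
    (limsup (fun ε : ℝ => ((1 / ε ^ 2 : ℝ) : EReal) *
        limsup (fun n : ℕ => logDevProb P X g θ n ε / ((n : ℝ) : EReal)) atTop) (𝓝[>] 0)
      ≤ ((-(m * (2 * m - 1) / (2 * (m + 1))) : ℝ) : EReal)) ∧
    (((-(m * (2 * m - 1) / (2 * (m + 1))) : ℝ) : EReal) ≤
      liminf (fun ε : ℝ => ((1 / ε ^ 2 : ℝ) : EReal) *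
        liminf (fun n : ℕ => logDevProb P X g θ n ε / ((n : ℝ) : EReal)) atTop) (𝓝[>] 0)) ∧
    (∀ lam : ℕ → ℝ, (∀ n, 1 ≤ n → 0 < lam n) → Tendsto lam atTop atTop →
      Tendsto (fun n : ℕ => lam n / Real.sqrt n) atTop (𝓝 0) →
      ∀ ε : ℝ, 0 < ε →
        Tendsto (fun n : ℕ => logDevProb P X g θ n (ε / lam n) / ((n / lam n ^ 2 : ℝ) : EReal))
          atTop (𝓝 ((-(m * (2 * m - 1) / (2 * (m + 1))) * ε ^ 2 : ℝ) : EReal))) := by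
  have hbounds {η : ℝ} (hη : 0 < η) := exists_logDevProb_bounds hm hX hindep hlaw hg hη
  set I := m * (2 * m - 1) / (2 * (m + 1)) with hI
  have hfixed {η : ℝ} (hη : 0 < η) : ∀ᶠ ε : ℝ in 𝓝[>] 0, 0 < ε ∧ ∀ᶠ n : ℕ in atTop,
      ((-(ε ^ 2 * (I + η)) : ℝ) : EReal) ≤ logDevProb P X g θ n ε / ((n : ℝ) : EReal) ∧
      logDevProb P X g θ n ε / ((n : ℝ) : EReal) ≤ ((-(ε ^ 2 * (I - η)) : ℝ) : EReal) := by
    obtain ⟨r₀, N₀, hr₀, h⟩ := hbounds hη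
    filter_upwards [Ioc_mem_nhdsGT hr₀] with ε hε
    refine ⟨hε.1, ?_⟩
    have hε2 : 0 < ε ^ 2 := pow_pos hε.1 2
    filter_upwards [eventually_ge_atTop 1,
      tendsto_natCast_atTop_atTop.eventually_ge_atTop (N₀ / ε ^ 2)] with n hn hN
    have hn0 : (0 : ℝ) < n := by exact_mod_cast hn
    obtain ⟨l, hl, h1, h2⟩ := h n hn ε hε.1 hε.2 ((div_le_iff₀ hε2).1 hN)
    rw [hl, ← EReal.coe_div, EReal.coe_le_coe_iff, EReal.coe_le_coe_iff, le_div_iff₀ hn0,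
      div_le_iff₀ hn0]
    constructor <;> linarith
  have hscale {ε : ℝ} (hε : 0 < ε) (y : ℝ) :
      ((1 / ε ^ 2 : ℝ) : EReal) * ((-(ε ^ 2 * y) : ℝ) : EReal) = ((-y : ℝ) : EReal) := by
    rw [← EReal.coe_mul]
    congr 1
    field_simp
  have hnn (ε : ℝ) : (0 : EReal) ≤ ((1 / ε ^ 2 : ℝ) : EReal) :=
    EReal.coe_nonneg.2 (by positivity)
  refine ⟨?_, ?_, ?_⟩
  · refine EReal.le_of_forall_lt_iff_le.1 fun z hz => ?_
    -- With η = z + I the upper rate -(I - η) is exactly z. The lower bound uses η = -I - z in the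
    -- same way.
    have hη : 0 < z + I := by
      have := EReal.coe_lt_coe_iff.1 hz
      linarith
    refine limsup_le_of_le (by isBoundedDefault) ?_
    filter_upwards [hfixed hη] with ε ⟨hε, h⟩
    have h1 : limsup (fun n : ℕ => logDevProb P X g θ n ε / ((n : ℝ) : EReal)) atTop ≤
        ((-(ε ^ 2 * (I - (z + I))) : ℝ) : EReal) :=
      limsup_le_of_le (by isBoundedDefault) (h.mono fun n hn => hn.2)
    refine (mul_le_mul_of_nonneg_left h1 (hnn ε)).trans ?_
    rw [hscale hε, EReal.coe_le_coe_iff]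
    linarith
  · refine EReal.ge_of_forall_gt_iff_ge.1 fun z hz => ?_
    have hη : 0 < -I - z := by
      have := EReal.coe_lt_coe_iff.1 hz
      linarith
    refine le_liminf_of_le (by isBoundedDefault) ?_
    filter_upwards [hfixed hη] with ε ⟨hε, h⟩
    have h1 : ((-(ε ^ 2 * (I + (-I - z))) : ℝ) : EReal) ≤
        liminf (fun n : ℕ => logDevProb P X g θ n ε / ((n : ℝ) : EReal)) atTop :=
      le_liminf_of_le (by isBoundedDefault) (h.mono fun n hn => hn.1)
    refine le_trans ?_ (mul_le_mul_of_nonneg_left h1 (hnn ε))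
    rw [hscale hε, EReal.coe_le_coe_iff]
    linarith
  · intro lam hlam hlam_top hlam_sqrt ε hε
    have key : ∀ η : ℝ, 0 < η → ∀ᶠ n : ℕ in atTop, ∃ l : ℝ,
        logDevProb P X g θ n (ε / lam n) / ((n / lam n ^ 2 : ℝ) : EReal) = l ∧
          |l - -I * ε ^ 2| ≤ ε ^ 2 * η := by
      intro η hη
      obtain ⟨r₀, N₀, hr₀, h⟩ := hbounds hη
      have hsq : Tendsto (fun n : ℕ => (lam n / Real.sqrt n) ^ 2) atTop (𝓝 0) := by
        simpa using hlam_sqrt.pow 2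
      -- Divergence of λₙ gives ε/λₙ ≤ r₀, and λₙ²/n → 0 gives n(ε/λₙ)² ≥ N₀. The +1 keeps the
      -- denominator positive when N₀ = 0.
      filter_upwards [eventually_ge_atTop 1, hlam_top.eventually_ge_atTop (ε / r₀),
        hsq.eventually_lt_const (show 0 < ε ^ 2 / (|N₀| + 1) by positivity)] with n hn hr hN
      have hn0 : (0 : ℝ) < n := by exact_mod_cast hn
      have hl0 := hlam n hn
      have hN' : N₀ ≤ n * (ε / lam n) ^ 2 := by
        rw [div_pow, Real.sq_sqrt hn0.le, div_lt_div_iff₀ hn0 (by positivity)] at hN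
        rw [div_pow, mul_div_assoc', le_div_iff₀ (by positivity)]
        have : N₀ * lam n ^ 2 ≤ (|N₀| + 1) * lam n ^ 2 := by
          gcongr
          linarith [le_abs_self N₀]
        linarith
      rw [div_le_iff₀ hr₀, ← div_le_iff₀' hl0] at hr
      obtain ⟨l, hl, h1, h2⟩ := h n hn (ε / lam n) (by positivity) hr hN'
      refine ⟨l / (n / lam n ^ 2), by rw [hl, ← EReal.coe_div], ?_⟩
      have hs : 0 < n / lam n ^ 2 := by positivity
      have he : n * (ε / lam n) ^ 2 = n / lam n ^ 2 * ε ^ 2 := by ring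
      rw [he] at h1 h2
      have h3 : -(ε ^ 2 * (I + η)) ≤ l / (n / lam n ^ 2) := by
        rw [le_div_iff₀ hs]; linarith
      have h4 : l / (n / lam n ^ 2) ≤ -(ε ^ 2 * (I - η)) := by
        rw [div_le_iff₀ hs]; linarith
      rw [abs_le]
      constructor <;> linarith
    have hreal : Tendsto (fun n : ℕ =>
        (logDevProb P X g θ n (ε / lam n) / ((n / lam n ^ 2 : ℝ) : EReal)).toReal)
        atTop (𝓝 (-I * ε ^ 2)) := by
      refine Metric.tendsto_nhds.2 fun d hd => ?_
      filter_upwards [key (d / (2 * ε ^ 2)) (by positivity)] with n ⟨l, hl, h⟩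
      rw [hl, EReal.toReal_coe, Real.dist_eq]
      refine h.trans_lt ?_
      have : ε ^ 2 * (d / (2 * ε ^ 2)) = d / 2 := by field_simp
      linarith
    refine (EReal.tendsto_coe.2 hreal).congr' ?_
    filter_upwards [key 1 one_pos] with n ⟨l, hl, _⟩
    rw [hl, EReal.toReal_coe]
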